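/- Let $p$ be a prime, let $\mathcal O$ be the ring of integers of a finite extension of $\mathbb Q_p$, let $d\ge 2$, and put $A=\mathcal O[[T_1,\dots,T_{d-1}]]$ and $B=A[[t]]$. For a finite extension $\mathcal O'$ of $\mathcal O$ (the ring of integers of a finite extension of $\operatorname{Frac}\mathcal O$) with maximal ideal $\mathfrak m'$, put $A'=A\otimes_{\mathcal O}\mathcal O'=\mathcal O'[[T_1,\dots,T_{d-1}]]$ and $B'=B\otimes_{\mathcal O}\mathcal O'=A'[[t]]$, and let $\pi':B'\to A'$ be the map $f(t)\mapsto f(0)$. For $\alpha\in 1+\mathfrak m'$ let $\mathrm{Tw}_\alpha:B'\to B'$ be the $A'$-algebra homomorphism $f(t)\mapsto f(\alpha(1+t)-1)$; for a $B'$-module $Y$ let $\mathrm{Tw}_\alpha(Y)$ be the $B'$-module with the same underlying abelian group as $Y$ on which $c\in B'$ acts as multiplication by $\mathrm{Tw}_\alpha(c)$ on $Y$. For a finitely generated module $M$ over $R=A'$ or $R=B$, the characteristic ideal is $$\mathrm{Char}_R(M)=\prod_{\mathfrak p}\mathfrak p^{\,\mathrm{length}_{R_{\mathfrak p}}(M_{\mathfrak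 p})}$$ ($\mathfrak p$ running over the primes of $R$ of height one) if $M$ is torsion, and $\mathrm{Char}_R(M)=0$ if $M$ is not torsion. Theorem. Let $X$ be a finitely generated $B$-module, let $b\in B$, and for each $\mathcal O'$ put $X'=X\otimes_{\mathcal O}\mathcal O'=B'\otimes_B X$. Suppose that for all finite extensions $\mathcal O'$ of $\mathcal O$ and all $\alpha\in 1+\mathfrak m'$ we have $$\pi'(\mathrm{Tw}_{\alpha^{-1}}(b))\in \mathrm{Char}_{A'}\bigl(\mathrm{Tw}_\alpha(X')/t\,\mathrm{Tw}_\alpha(X')\bigr).$$ Then $b\in\mathrm{Char}_B(X)$. In particular, if $b\ne 0$, then $X$ is a torsion $B$-module. -/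

import Mathlib

open IsLocalRing
open scoped TensorProduct

universe u v

noncomputable section

namespace IwasawaSpec

/-! ### Complete local rings -/

/-- If `m` is an ideal with `m ^ k ≤ J ≤ m`, then `J`-adic completeness gives `m`-adic
completeness. -/
theorem isAdicComplete_of_pow_le {S : Type*} [CommRing S] {J m : Ideal S} {k : ℕ}
    (h₁ : m ^ k ≤ J) (h₂ : J ≤ m) (h : IsAdicComplete J S) : IsAdicComplete m S := by
  let _ : WithIdeal S := ⟨J⟩
  have hJ : IsAdic J := rfl
  have hm : IsAdic m := by
    rw [isAdic_iff] at hJ ⊢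
    refine ⟨fun n => ?_, fun s hs => ?_⟩
    · exact AddSubgroup.isOpen_mono (H₁ := (J ^ n).toAddSubgroup)
        (H₂ := (m ^ n).toAddSubgroup) (Ideal.pow_right_mono h₂ n) (hJ.1 n)
    · obtain ⟨n, hn⟩ := hJ.2 s hs
      refine ⟨k * n, le_trans ?_ hn⟩
      rw [pow_mul]
      exact Ideal.pow_right_mono h₁ n
  exact hm.isAdicComplete_iff.2 (hJ.isAdicComplete_iff.1 h)

/-- A local ring which is finite over a complete Noetherian local ring is complete. -/
theorem isAdicComplete_of_finite (R S : Type u) [CommRing R] [IsLocalRing R] [IsNoetherianRing R]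
    [IsAdicComplete (maximalIdeal R) R] [CommRing S] [IsLocalRing S] [Algebra R S]
    [Module.Finite R S] : IsAdicComplete (maximalIdeal S) S := by
  set I := maximalIdeal R
  have hS : IsAdicComplete I S := by
    rw [← AdicCompletion.of_bijective_iff]
    have hb := AdicCompletion.ofTensorProduct_bijective_of_finite_of_isNoetherian I S
    let e : S ≃ₗ[R] AdicCompletion I R ⊗[R] S :=
      (TensorProduct.lid R S).symm ≪≫ₗ
        TensorProduct.congr (AdicCompletion.ofLinearEquiv I R) (LinearEquiv.refl R S)
    have : (AdicCompletion.of I S : S → AdicCompletion I S) =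
        AdicCompletion.ofTensorProduct I S ∘ e := by
      ext x n
      have h1 : e x = 1 ⊗ₜ x := rfl
      rw [Function.comp_apply, h1, AdicCompletion.ofTensorProduct_tmul, one_smul]
    rw [this]
    exact hb.comp e.bijective
  have hJ : IsAdicComplete (I.map (algebraMap R S)) S := (IsAdicComplete.map_algebraMap_iff I S).2 hS
  have hle : I.map (algebraMap R S) ≤ maximalIdeal S := by
    rw [Ideal.map_le_iff_le_comap]
    have : ((maximalIdeal S).comap (algebraMap R S)).IsMaximal :=
      Ideal.isMaximal_comap_of_isIntegral_of_isMaximal _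
    rw [eq_maximalIdeal this]
  have : IsArtinianRing (S ⧸ I.map (algebraMap R S)) := by
    let _ : Field (R ⧸ I) := Ideal.Quotient.field I
    have : Module.Finite (R ⧸ I) (S ⧸ I.map (algebraMap R S)) :=
      Module.Finite.of_restrictScalars_finite R _ _
    exact IsArtinianRing.of_finite (R ⧸ I) _
  obtain ⟨k, hk⟩ := exists_maximalIdeal_pow_le_of_isArtinianRing_quotient
    (I.map (algebraMap R S))
  exact isAdicComplete_of_pow_le hk hle hJ

/-- A local ring which is finite over `ℤ_p` is complete. -/
theorem isAdicComplete_of_finite_padicInt (p : ℕ) [Fact p.Prime] (S : Type u) [CommRing S]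
    [IsLocalRing S] [Algebra ℤ_[p] S] [Module.Finite ℤ_[p] S] :
    IsAdicComplete (maximalIdeal S) S := by
  let e : ℤ_[p] ≃+* ULift.{u} ℤ_[p] := ULift.ringEquiv.symm
  have : IsLocalRing (ULift.{u} ℤ_[p]) := e.isLocalRing
  have : IsNoetherianRing (ULift.{u} ℤ_[p]) := isNoetherianRing_of_ringEquiv _ e
  have : IsAdicComplete (maximalIdeal (ULift.{u} ℤ_[p])) (ULift.{u} ℤ_[p]) := by
    have h : (maximalIdeal ℤ_[p]).map e = maximalIdeal (ULift.{u} ℤ_[p]) :=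
      eq_maximalIdeal (Ideal.map_isMaximal_of_equiv e)
    rw [← h, IsAdicComplete.congr_ringEquiv]
    infer_instance
  let _ : Algebra (ULift.{u} ℤ_[p]) S :=
    { algebraMap := (algebraMap ℤ_[p] S).comp e.symm.toRingHom
      commutes' := fun _ _ => mul_comm _ _
      smul_def' := fun x s => Algebra.smul_def x.down s }
  have : Module.Finite (ULift.{u} ℤ_[p]) S := Module.Finite.of_restrictScalars_finite ℤ_[p] _ _
  exact isAdicComplete_of_finite (ULift.{u} ℤ_[p]) S

/-! ### Twists -/

/-- The subgroup `1 + 𝔪` of the units of a local ring `R` with maximal ideal `𝔪`. -/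
def principalUnits (R : Type u) [CommRing R] [IsLocalRing R] : Subgroup Rˣ where
  carrier := {α | (α : R) - 1 ∈ maximalIdeal R}
  one_mem' := by simp
  mul_mem' {α β} hα hβ := by
    have h : ((α * β : Rˣ) : R) - 1 = α * ((β : R) - 1) + ((α : R) - 1) := by
      push_cast; ring
    change ((α * β : Rˣ) : R) - 1 ∈ maximalIdeal R
    rw [h]
    exact add_mem (Ideal.mul_mem_left _ _ hβ) hα
  inv_mem' {α} hα := by
    have h : ((α⁻¹ : Rˣ) : R) - 1 = -((α⁻¹ : Rˣ) : R) * ((α : R) - 1) := by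
      rw [mul_sub, neg_mul, Units.inv_mul]; ring
    change ((α⁻¹ : Rˣ) : R) - 1 ∈ maximalIdeal R
    rw [h]
    exact Ideal.mul_mem_left _ _ hα

section Twist

variable (n : ℕ) {R : Type u} [CommRing R]

/-- The ring `A = R⟦T₁, …, Tₙ⟧`. -/
abbrev RingA (n : ℕ) (R : Type u) [CommRing R] : Type u := MvPowerSeries (Fin n) R

/-- The ring `B = A⟦t⟧`, with variable `t = PowerSeries.X`. -/
abbrev RingB (n : ℕ) (R : Type u) [CommRing R] : Type u := PowerSeries (RingA n R)

variable [IsLocalRing R] [IsAdicComplete (maximalIdeal R) R]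

open scoped MvPowerSeries.WithPiTopology PowerSeries.WithPiTopology in
/-- The `A`-algebra homomorphism `Tw_α : B → B`, `f(t) ↦ f(α(1 + t) - 1)`, for `α ∈ 1 + 𝔪`.
Here `R` has the `𝔪`-adic topology, `A` and `B` have the topologies of coefficientwise
convergence, and `f(α(1 + t) - 1)` is the sum of the convergent series
`∑ aᵢ (α(1 + t) - 1)ⁱ` if `f = ∑ aᵢ tⁱ`. -/
def twist (α : principalUnits R) : RingB n R →ₐ[RingA n R] RingB n R :=
  letI : WithIdeal R := ⟨maximalIdeal R⟩
  haveI hR : CompleteSpace R ∧ T2Space R :=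
    (show IsAdic (maximalIdeal R) from rfl).isAdicComplete_iff.1 inferInstance
  haveI := hR.1
  haveI := hR.2
  PowerSeries.aeval (R := RingA n R) (S := RingB n R)
    (a := PowerSeries.C (MvPowerSeries.C ((α : Rˣ) : R)) * (1 + PowerSeries.X) - 1) (by
      refine MvPowerSeries.LinearTopology.isTopologicallyNilpotent_of_constantCoeff ?_
      refine MvPowerSeries.LinearTopology.isTopologicallyNilpotent_of_constantCoeff ?_
      refine WithIdeal.isTopologicallyNilpotent_of_mem ?_
      change MvPowerSeries.constantCoeff (PowerSeries.constantCoeff (R := RingA n R) _) ∈ maximalIdeal R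
      have hα : ((α : Rˣ) : R) - 1 ∈ maximalIdeal R := α.2
      simpa using hα)

open scoped MvPowerSeries.WithPiTopology PowerSeries.WithPiTopology in
theorem twist_X (α : principalUnits R) :
    twist n α PowerSeries.X = PowerSeries.C (MvPowerSeries.C ((α : Rˣ) : R)) * (1 + PowerSeries.X) - 1 := by
  let _ : WithIdeal R := ⟨maximalIdeal R⟩
  have hR : CompleteSpace R ∧ T2Space R :=
    (show IsAdic (maximalIdeal R) from rfl).isAdicComplete_iff.1 inferInstance
  have := hR.1
  have := hR.2
  have h : twist n α ((Polynomial.X : Polynomial (RingA n R)) : PowerSeries (RingA n R)) = _ :=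
    (PowerSeries.aeval_coe _ _).trans (Polynomial.aeval_X _)
  rwa [Polynomial.coe_X] at h

/-- The `B`-module `Tw_α(X)`: the underlying abelian group is that of `X`, and `b ∈ B` acts as
`Tw_α(b)` acts on `X`. -/
def TwistModule (_α : principalUnits R) (X : Type v) : Type v := X

instance (α : principalUnits R) (X : Type v) [AddCommGroup X] :
    AddCommGroup (TwistModule α X) := inferInstanceAs (AddCommGroup X)

instance (α : principalUnits R) (X : Type v) [AddCommGroup X] [Module (RingB n R) X] :
    Module (RingB n R) (TwistModule α X) :=
  Module.compHom X (twist n α).toRingHom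

end Twist

/-- The `A`-module `X / t X` attached to a `B`-module `X`. -/
def QuotT (n : ℕ) (R : Type u) [CommRing R] (X : Type v) [AddCommGroup X]
    [Module (RingB n R) X] : Type v :=
  X ⧸ (Ideal.span {(PowerSeries.X : RingB n R)} • ⊤ : Submodule (RingB n R) X)

instance (n : ℕ) (R : Type u) [CommRing R] (X : Type v) [AddCommGroup X]
    [Module (RingB n R) X] : AddCommGroup (QuotT n R X) :=
  inferInstanceAs (AddCommGroup (X ⧸ (Ideal.span {(PowerSeries.X : RingB n R)} • ⊤ :
    Submodule (RingB n R) X)))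

instance (n : ℕ) (R : Type u) [CommRing R] (X : Type v) [AddCommGroup X]
    [Module (RingB n R) X] : Module (RingB n R) (QuotT n R X) :=
  inferInstanceAs (Module (RingB n R) (X ⧸ (Ideal.span {(PowerSeries.X : RingB n R)} • ⊤ :
    Submodule (RingB n R) X)))

instance (n : ℕ) (R : Type u) [CommRing R] (X : Type v) [AddCommGroup X]
    [Module (RingB n R) X] : Module (RingA n R) (QuotT n R X) :=
  Module.compHom _ (algebraMap (RingA n R) (RingB n R))

/-! ### Characteristic ideals -/

open Classical in
/-- The characteristic ideal of a finitely generated module `M` over a Noetherian normal domain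
`R` all of whose height one primes are principal: the product of the `𝔭 ^ length (M_𝔭)` over the
primes `𝔭` of height one if `M` is torsion, and `0` if `M` is not torsion. -/
def charIdeal (R : Type u) [CommRing R] (M : Type v) [AddCommGroup M] [Module R M] : Ideal R :=
  if Module.IsTorsion R M then
    ∏ᶠ p : {p : PrimeSpectrum R // p.asIdeal.height = 1},
      p.1.asIdeal ^ (Module.length (Localization.AtPrime p.1.asIdeal)
        (LocalizedModule p.1.asIdeal.primeCompl M)).toNat
  else ⊥

end IwasawaSpec

end

/-! Fix generators `x` of `X` and consider all square matrices whose rows are relations between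
them. Their determinants generate the zeroth Fitting ideal. Over a Noetherian factorial domain the
characteristic ideal of a torsion module is generated by the gcd of these determinants: at a height
one prime the localization is a discrete valuation ring, where Smith normal form identifies the
length with the least valuation of a determinant (`dvd_of_mem_charIdeal`,
`exists_charIdeal_eq_span`). A module is non-torsion exactly when all the determinants vanish. So
everything follows from one claim: every common divisor `g` of the determinants divides `b`. For
torsion `X` take `g` to be a generator of the characteristic ideal; otherwise take `g = 0`.

The claim is checked at points, that is, at `O`-algebra homomorphisms `ψ : B → O'` into finite
extensions. Fitting ideals commute with base change, and `Tw_α(X')/t` is the base change of `X`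
along `π' ∘ Tw_{α⁻¹}`. Hence the specialization of `g` divides all determinants for this module, and
by hypothesis it divides the specialization of `b` (`constantCoeff_twist_dvd`). Every `ψ` factors
through such a specialization, with `α⁻¹ = 1 + ψ(t)` (`exists_algHom_comp_twist`), so `ψ(g) ∣ ψ(b)`
for all `ψ`.

Finally, pointwise divisibility implies divisibility (`ringB_dvd_of_forall_apply_dvd`). Powers of
the uniformizer are removed using a point at which a series prime to it has a value prime to it
(`exists_not_dvd_apply`). After a change of variables, Weierstrass preparation replaces the divisor
by a distinguished polynomial `F`, and Weierstrass division of `b` by `F` leaves a polynomial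
remainder of smaller degree. Specializing the coefficients and splitting `F` over a finite
extension, pointwise divisibility makes `F` divide the remainder, which must vanish
(`coe_dvd_of_forall_apply_dvd`). The same preparation theorem with Gauss's lemma shows that `A'` and
`B` are factorial. -/

noncomputable section

namespace IwasawaSpec

/-! ### Relation matrices -/

section RelationMatrix

variable {ι : Type*} [Fintype ι]

/-- `A` is a relation matrix for the family `x` if each row of `A` is a linear relation
between the `x j`. -/
def IsRelationMatrix {R M : Type*} [CommRing R] [AddCommGroup M] [Module R M]
    (x : ι → M) (A : Matrix ι ι R) : Prop :=
  ∀ i, ∑ j, A i j • x j = 0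

section Basic

variable {R M N : Type*} [CommRing R] [AddCommGroup M] [Module R M] [AddCommGroup N] [Module R N]
  {x : ι → M}

theorem IsRelationMatrix.map {A : Matrix ι ι R} (hA : IsRelationMatrix x A) (f : M →ₗ[R] N) :
    IsRelationMatrix (f ∘ x) A := fun i => by
  simpa using congrArg f (hA i)

theorem IsRelationMatrix.mul_left {A : Matrix ι ι R} (hA : IsRelationMatrix x A)
    (C : Matrix ι ι R) : IsRelationMatrix x (C * A) := fun i => by
  simp_rw [Matrix.mul_apply, Finset.sum_smul, mul_smul]
  rw [Finset.sum_comm]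
  simp_rw [← Finset.smul_sum, hA _, smul_zero, Finset.sum_const_zero]

variable [DecidableEq ι]

/-- Cramer's rule: multiply the relations by the adjugate. -/
theorem IsRelationMatrix.det_smul {A : Matrix ι ι R} (hA : IsRelationMatrix x A) (i : ι) :
    A.det • x i = 0 := by
  have h := hA.mul_left A.adjugate i
  simpa [Matrix.adjugate_mul, Matrix.smul_apply, Matrix.one_apply] using h

theorem isRelationMatrix_smul_one {a : R} (ha : ∀ i, a • x i = 0) :
    IsRelationMatrix x (a • (1 : Matrix ι ι R)) := fun i => by
  simp [Matrix.smul_apply, Matrix.one_apply, ha]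

theorem IsRelationMatrix.det_smul_eq_zero (hx : Submodule.span R (Set.range x) = ⊤)
    {A : Matrix ι ι R} (hA : IsRelationMatrix x A) (m : M) : A.det • m = 0 := by
  have h : Submodule.span R (Set.range x) ≤ Submodule.torsionBy R M A.det :=
    Submodule.span_le.2 (by
      rintro _ ⟨i, rfl⟩
      exact (Submodule.mem_torsionBy_iff _ _).2 (hA.det_smul i))
  rw [hx] at h
  exact (Submodule.mem_torsionBy_iff _ _).1 (h trivial)

theorem isTorsion_iff_exists_relationMatrix [IsDomain R]
    (hx : Submodule.span R (Set.range x) = ⊤) :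
    Module.IsTorsion R M ↔ ∃ A : Matrix ι ι R, IsRelationMatrix x A ∧ A.det ≠ 0 := by
  constructor
  · intro h
    choose a ha using fun i => @h (x i)
    refine ⟨(∏ i, (a i : R)) • 1, isRelationMatrix_smul_one fun i => ?_, ?_⟩
    · rw [← Finset.mul_prod_erase _ _ (Finset.mem_univ i), mul_comm, mul_smul]
      have h1 : (a i : R) • x i = 0 := ha i
      rw [h1, smul_zero]
    · rw [Matrix.det_smul, Matrix.det_one, mul_one]
      exact pow_ne_zero _ (Finset.prod_ne_zero_iff.2 fun i _ => nonZeroDivisors.ne_zero (a i).2)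
  · rintro ⟨A, hA, h0⟩ m
    exact ⟨⟨A.det, mem_nonZeroDivisors_of_ne_zero h0⟩, hA.det_smul_eq_zero hx m⟩

end Basic

variable [DecidableEq ι]

/-- Over a principal ideal domain, the module of relations of a torsion module is generated by the
rows of a square matrix, whose determinant computes the length. -/
theorem exists_generating_relationMatrix {R M : Type*} [CommRing R] [IsDomain R]
    [IsPrincipalIdealRing R] [AddCommGroup M] [Module R M] {x : ι → M}
    (hx : Submodule.span R (Set.range x) = ⊤)
    (h : ∃ A : Matrix ι ι R, IsRelationMatrix x A ∧ A.det ≠ 0) :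
    ∃ D : Matrix ι ι R, IsRelationMatrix x D ∧ D.det ≠ 0 ∧ Module.length R M = Ring.ord R D.det ∧
      ∀ A : Matrix ι ι R, IsRelationMatrix x A → D.det ∣ A.det := by
  obtain ⟨A₀, hA₀, hdet⟩ := h
  set φ : (ι → R) →ₗ[R] M := Fintype.linearCombination R x with hφ
  have hφs : Function.Surjective φ := by
    rw [← LinearMap.range_eq_top, hφ, Fintype.range_linearCombination, hx]
  set N := LinearMap.ker φ with hN
  have mem_N : ∀ v : ι → R, v ∈ N ↔ ∑ j, v j • x j = 0 := fun v => by
    rw [hN, LinearMap.mem_ker, hφ, Fintype.linearCombination_apply]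
  -- The rows of `A₀` are independent relations, so the relation module has full rank and its Smith
  -- normal form has one nonzero coefficient for each generator.
  have hrank : Module.finrank R N = Module.finrank R (ι → R) := by
    refine le_antisymm (Submodule.finrank_le N) ?_
    have hli : LinearIndependent R A₀.row :=
      Matrix.linearIndependent_rows_of_det_ne_zero hdet
    have hli' : LinearIndependent R (fun i => (⟨A₀ i, (mem_N _).2 (hA₀ i)⟩ : N)) :=
      LinearIndependent.of_comp N.subtype hli
    simpa using hli'.fintype_card_le_finrank
  let b := Pi.basisFun R ι
  let b' := Submodule.smithNormalFormTopBasis b hrank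
  let a := Submodule.smithNormalFormCoeffs b hrank
  let c := Submodule.smithNormalFormBotBasis b hrank
  have hc : ∀ i, (c i : ι → R) = a i • b' i := Submodule.smithNormalFormBotBasis_def b hrank
  have ha : ∀ i, a i ≠ 0 := Submodule.smithNormalFormCoeffs_ne_zero b hrank
  set D : Matrix ι ι R := Matrix.of fun i => (c i : ι → R) with hD
  have hDdet : D.det = (∏ i, a i) * b.det b' := by
    have h1 : D = Matrix.of fun i j => a i * (Matrix.of (fun i j => b' i j)) i j := by
      ext i j
      simp [hD, hc]
    rw [h1, Matrix.det_mul_column, Module.Basis.det_apply, ← Matrix.det_transpose]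
    congr 1
  have hunit : IsUnit (b.det b') := b.isUnit_det b'
  refine ⟨D, fun i => (mem_N _).1 (c i).2, ?_, ?_, fun A hA => ?_⟩
  · rw [hDdet]
    exact mul_ne_zero (Finset.prod_ne_zero_iff.2 fun i _ => ha i) hunit.ne_zero
  · rw [hDdet, Ring.ord_mul_of_isUnit_right hunit]
    rw [← (φ.quotKerEquivOfSurjective hφs).length_eq,
      (Submodule.quotientEquivPiSpan N b hrank).length_eq, Module.length_pi_of_fintype]
    have key : ∀ s : Finset ι, ∑ i ∈ s, Ring.ord R (a i) = Ring.ord R (∏ i ∈ s, a i) := fun s => by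
      induction s using Finset.induction_on with
      | empty => simp
      | insert i s hi ih =>
        rw [Finset.sum_insert hi, Finset.prod_insert hi, ih,
          Ring.ord_mul' _ (mem_nonZeroDivisors_of_ne_zero (ha i))]
    exact key Finset.univ
  -- The rows of `D` form a basis of the relation module; `C` holds the coordinates of the rows of
  -- `A` in it.
  · let C : Matrix ι ι R := Matrix.of fun i k => c.repr ⟨A i, (mem_N _).2 (hA i)⟩ k
    have hAC : A = C * D := by
      ext i j
      have h1 := congrArg (fun w : N => (w : ι → R) j)
        (c.sum_repr ⟨A i, (mem_N _).2 (hA i)⟩)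
      simp only [Submodule.coe_sum, Submodule.coe_smul, Finset.sum_apply, Pi.smul_apply,
        smul_eq_mul] at h1
      rw [Matrix.mul_apply]
      exact h1.symm
    rw [hAC, Matrix.det_mul]
    exact dvd_mul_left _ _

/-- In the situation of a discrete valuation ring with uniformizer `ϖ`, the determinants of the
relation matrices generate `ϖ ^ length`. -/
theorem exists_relationMatrix_associated_pow {R M : Type*} [CommRing R] [IsDomain R]
    [IsDiscreteValuationRing R] [AddCommGroup M] [Module R M] {x : ι → M}
    (hx : Submodule.span R (Set.range x) = ⊤)
    (h : ∃ A : Matrix ι ι R, IsRelationMatrix x A ∧ A.det ≠ 0) {ϖ : R} (hϖ : Irreducible ϖ) :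
    (∃ D : Matrix ι ι R, IsRelationMatrix x D ∧
      Associated D.det (ϖ ^ (Module.length R M).toNat)) ∧
    ∀ A : Matrix ι ι R, IsRelationMatrix x A → ϖ ^ (Module.length R M).toNat ∣ A.det := by
  obtain ⟨D, hD, hD0, hlen, hdvd⟩ := exists_generating_relationMatrix hx h
  obtain ⟨k, hk⟩ := IsDiscreteValuationRing.associated_pow_irreducible hD0 hϖ
  have hl : (Module.length R M).toNat = k := by
    rw [hlen, Ring.ord_eq_of_associated hk,
      Ring.ord_pow (mem_nonZeroDivisors_of_ne_zero hϖ.ne_zero), Ring.ord_of_irreducible hϖ]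
    simp
  rw [hl]
  exact ⟨⟨D, hD, hk⟩, fun A hA => hk.symm.dvd.trans (hdvd A hA)⟩

/-- Common denominators for relation matrices over a localization. -/
theorem exists_relationMatrix_of_localized {R M : Type*} [CommRing R] (S : Submonoid R)
    [AddCommGroup M] [Module R M] {x : ι → M} {A : Matrix ι ι (Localization S)}
    (hA : IsRelationMatrix (fun i => LocalizedModule.mkLinearMap S M (x i)) A) :
    ∃ s ∈ S, ∃ A₀ : Matrix ι ι R, IsRelationMatrix x A₀ ∧
      A₀.map (algebraMap R (Localization S)) = algebraMap R (Localization S) s • A := by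
  obtain ⟨s, hs⟩ := IsLocalization.exist_integer_multiples_of_finite S
    (fun ij : ι × ι => A ij.1 ij.2)
  choose A₁ hA₁ using fun i j => hs (i, j)
  -- Once the entries are integral, each row is a relation only in the localization; a further
  -- factor `t i` makes it one in `M`.
  have h1 : ∀ i, ∃ t : S, t • ∑ j, A₁ i j • x j = 0 := fun i => by
    have h2 : LocalizedModule.mkLinearMap S M (∑ j, A₁ i j • x j) = 0 := by
      have h3 : ∀ j, A₁ i j • LocalizedModule.mkLinearMap S M (x j) =
          (s : R) • (A i j • LocalizedModule.mkLinearMap S M (x j)) := fun j => by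
        rw [← algebraMap_smul (Localization S) (A₁ i j), hA₁, smul_assoc]
      rw [map_sum]
      simp_rw [map_smul, h3]
      rw [← Finset.smul_sum, hA i, smul_zero]
    rw [← map_zero (LocalizedModule.mkLinearMap S M)] at h2
    obtain ⟨t, ht⟩ := IsLocalizedModule.exists_of_eq (S := S) h2
    exact ⟨t, by simpa using ht⟩
  choose t ht using h1
  refine ⟨(∏ i, (t i : R)) * s, mul_mem (prod_mem fun i _ => (t i).2) s.2,
    Matrix.of fun i j => (∏ i, (t i : R)) * A₁ i j, fun i => ?_, ?_⟩
  · simp_rw [Matrix.of_apply, mul_smul]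
    rw [← Finset.smul_sum, ← Finset.mul_prod_erase _ _ (Finset.mem_univ i), mul_comm, mul_smul]
    have h1 : (t i : R) • ∑ j, A₁ i j • x j = 0 := ht i
    rw [h1, smul_zero]
  · ext i j
    have := hA₁ i j
    simp only [Matrix.map_apply, Matrix.of_apply, map_mul, Matrix.smul_apply, smul_eq_mul]
    rw [hA₁, mul_assoc]
    congr 1
    rw [Algebra.smul_def]

end RelationMatrix

/-! ### Characteristic ideals and relation matrices -/

section PrincipalPrime

variable {R : Type*} [CommRing R] {p : Ideal R} [p.IsPrime] {q : R}

theorem prime_of_eq_span (hq0 : q ≠ 0) (hp : p = Ideal.span {q}) : Prime q :=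
  (Ideal.span_singleton_prime hq0).1 (hp ▸ inferInstance)

theorem maximalIdeal_localization_eq_span (hp : p = Ideal.span {q}) :
    maximalIdeal (Localization.AtPrime p) =
      Ideal.span {algebraMap R (Localization.AtPrime p) q} := by
  rw [← Localization.AtPrime.map_eq_maximalIdeal]
  conv_lhs => arg 2; rw [hp]
  rw [Ideal.map_span, Set.image_singleton]

variable [IsDomain R]

theorem isDiscreteValuationRing_localization_of_eq_span [IsNoetherianRing R]
    (hq0 : q ≠ 0) (hp : p = Ideal.span {q}) :
    IsDiscreteValuationRing (Localization.AtPrime p) := by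
  have hm := maximalIdeal_localization_eq_span hp
  have : IsNoetherianRing (Localization.AtPrime p) :=
    IsLocalization.isNoetherianRing p.primeCompl _ inferInstance
  have hinj : Function.Injective (algebraMap R (Localization.AtPrime p)) :=
    IsLocalization.injective _ p.primeCompl_le_nonZeroDivisors
  have hf : ¬ IsField (Localization.AtPrime p) := by
    rw [isField_iff_maximalIdeal_eq, hm, Ideal.span_singleton_eq_bot]
    exact fun h => hq0 (hinj (h.trans (map_zero _).symm))
  exact ((IsDiscreteValuationRing.TFAE (Localization.AtPrime p) hf).out 0 4 :
    _ ↔ (maximalIdeal (Localization.AtPrime p)).IsPrincipal).2 ⟨⟨_, hm⟩⟩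

theorem irreducible_algebraMap_localization_of_eq_span [IsNoetherianRing R]
    (hq0 : q ≠ 0) (hp : p = Ideal.span {q}) :
    Irreducible (algebraMap R (Localization.AtPrime p) q) := by
  have := isDiscreteValuationRing_localization_of_eq_span hq0 hp
  rw [IsDiscreteValuationRing.irreducible_iff_uniformizer]
  exact maximalIdeal_localization_eq_span hp

theorem pow_dvd_algebraMap_localization_iff (hq0 : q ≠ 0) (hp : p = Ideal.span {q})
    (a : R) (k : ℕ) :
    (algebraMap R (Localization.AtPrime p) q) ^ k ∣ algebraMap R (Localization.AtPrime p) a ↔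
      q ^ k ∣ a := by
  constructor
  · rintro ⟨c, hc⟩
    obtain ⟨⟨c₀, s⟩, hs⟩ := IsLocalization.surj p.primeCompl c
    have hinj : Function.Injective (algebraMap R (Localization.AtPrime p)) :=
      IsLocalization.injective _ p.primeCompl_le_nonZeroDivisors
    have h1 : a * s = q ^ k * c₀ := by
      apply hinj
      rw [map_mul, hc, mul_assoc, hs, map_mul, map_pow]
    have hs' : ¬ q ∣ s := fun h => s.2 (hp.ge (Ideal.mem_span_singleton.2 h))
    exact (prime_of_eq_span hq0 hp).pow_dvd_of_dvd_mul_right k hs' ⟨c₀, h1⟩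
  · intro h
    rw [← map_pow]
    exact map_dvd _ h

/-- The determinants of the relation matrices of a torsion module `M` compute the length of `M` at
a principal prime. -/
theorem length_localization_of_relationMatrix [IsNoetherianRing R] (hq0 : q ≠ 0)
    (hp : p = Ideal.span {q}) {ι M : Type*} [Fintype ι] [DecidableEq ι] [AddCommGroup M]
    [Module R M] {x : ι → M} (hx : Submodule.span R (Set.range x) = ⊤)
    (h : ∃ A : Matrix ι ι R, IsRelationMatrix x A ∧ A.det ≠ 0) :
    (∀ A : Matrix ι ι R, IsRelationMatrix x A → q ^ (Module.length (Localization.AtPrime p)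
        (LocalizedModule p.primeCompl M)).toNat ∣ A.det) ∧
    ∃ A : Matrix ι ι R, IsRelationMatrix x A ∧ ∀ k, q ^ k ∣ A.det →
      k ≤ (Module.length (Localization.AtPrime p) (LocalizedModule p.primeCompl M)).toNat := by
  have := isDiscreteValuationRing_localization_of_eq_span hq0 hp
  have hirr := irreducible_algebraMap_localization_of_eq_span hq0 hp
  have hinj : Function.Injective (algebraMap R (Localization.AtPrime p)) :=
    IsLocalization.injective _ p.primeCompl_le_nonZeroDivisors
  set L := Localization.AtPrime p
  let x' : ι → LocalizedModule p.primeCompl M :=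
    fun i => LocalizedModule.mkLinearMap p.primeCompl M (x i)
  have hx' : Submodule.span L (Set.range x') = ⊤ := by
    have := span_eq_top_of_isLocalizedModule L p.primeCompl
      (LocalizedModule.mkLinearMap p.primeCompl M) hx
    rwa [← Set.range_comp] at this
  have hmap : ∀ A : Matrix ι ι R, IsRelationMatrix x A →
      IsRelationMatrix x' (A.map (algebraMap R L)) := fun A hA i => by
    have := hA.map (LocalizedModule.mkLinearMap p.primeCompl M) i
    simpa [x', L, algebraMap_smul] using this
  have hdetmap : ∀ A : Matrix ι ι R, (A.map (algebraMap R L)).det = algebraMap R L A.det :=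
    fun A => (RingHom.map_det _ A).symm
  have h' : ∃ A : Matrix ι ι L, IsRelationMatrix x' A ∧ A.det ≠ 0 := by
    obtain ⟨A, hA, hA0⟩ := h
    refine ⟨_, hmap A hA, ?_⟩
    rw [hdetmap]
    exact (map_ne_zero_iff _ hinj).2 hA0
  obtain ⟨⟨D, hD, hDa⟩, hdvd⟩ := exists_relationMatrix_associated_pow hx' h' hirr
  refine ⟨fun A hA => ?_, ?_⟩
  · rw [← pow_dvd_algebraMap_localization_iff hq0 hp, ← hdetmap]
    exact hdvd _ (hmap A hA)
  -- Clearing denominators scales the optimal local matrix by an element that is a unit at `p`, so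
  -- the valuation of its determinant is unchanged.
  · obtain ⟨s, hs, A₀, hA₀, hA₀D⟩ := exists_relationMatrix_of_localized p.primeCompl hD
    refine ⟨A₀, hA₀, fun k hk => ?_⟩
    rw [← pow_dvd_algebraMap_localization_iff hq0 hp, ← hdetmap, hA₀D, Matrix.det_smul] at hk
    have hu : IsUnit (algebraMap R L s) := IsLocalization.map_units L (⟨s, hs⟩ : p.primeCompl)
    rw [(hu.pow _).dvd_mul_left, hDa.dvd_iff_dvd_right] at hk
    exact (pow_dvd_pow_iff hirr.ne_zero hirr.not_isUnit).1 hk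

end PrincipalPrime

section CharIdeal

variable {R : Type u} [CommRing R] [IsDomain R] [UniqueFactorizationMonoid R]
  {ι : Type*} [Fintype ι] [DecidableEq ι] {M : Type v} [AddCommGroup M] [Module R M] {x : ι → M}

theorem exists_eq_span_of_height_eq_one (p : {p : PrimeSpectrum R // p.asIdeal.height = 1}) :
    ∃ q : R, q ≠ 0 ∧ p.1.asIdeal = Ideal.span {q} := by
  obtain ⟨q, hq⟩ := UniqueFactorizationMonoid.isPrincipal_of_height_eq_one p.2
  refine ⟨q, ?_, hq⟩
  rintro rfl
  exact Ideal.ne_bot_of_height_eq_one p.2 (by rw [hq]; simp)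

variable [IsNoetherianRing R]

/-- A height one prime with a nontrivial factor contains a fixed nonzero determinant, so it is a
minimal prime over that determinant; a Noetherian ring has only finitely many of these. -/
theorem finite_mulSupport_charIdeal (hx : Submodule.span R (Set.range x) = ⊤)
    (h : ∃ A : Matrix ι ι R, IsRelationMatrix x A ∧ A.det ≠ 0) :
    (Function.mulSupport fun p : {p : PrimeSpectrum R // p.asIdeal.height = 1} =>
      p.1.asIdeal ^ (Module.length (Localization.AtPrime p.1.asIdeal)
        (LocalizedModule p.1.asIdeal.primeCompl M)).toNat).Finite := by
  obtain ⟨A, hA, hA0⟩ := id h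
  have hfin := (Ideal.span {A.det}).finite_minimalPrimes_of_isNoetherianRing R
  refine Set.Finite.of_finite_image (f := fun p => p.1.asIdeal) (hfin.subset ?_) ?_
  · rintro _ ⟨p, hp, rfl⟩
    obtain ⟨q, hq0, hq⟩ := exists_eq_span_of_height_eq_one p
    have h1 := (length_localization_of_relationMatrix hq0 hq hx h).1 A hA
    have hl : (Module.length (Localization.AtPrime p.1.asIdeal)
        (LocalizedModule p.1.asIdeal.primeCompl M)).toNat ≠ 0 := fun h0 => hp (by
      simp only [h0, pow_zero])
    have hfh : p.1.asIdeal.FiniteHeight := by simp [Ideal.finiteHeight_iff, p.2]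
    refine Ideal.mem_minimalPrimes_of_height_le ?_ ?_
    · rw [Ideal.span_singleton_le_iff_mem]
      exact hq.ge (Ideal.mem_span_singleton.2 ((dvd_pow_self q hl).trans h1))
    · refine p.2.le.trans ?_
      exact Ideal.one_le_height_span_singleton_of_mem_nonZeroDivisors
        (mem_nonZeroDivisors_of_ne_zero hA0)
  · exact fun a _ b _ hab => Subtype.ext (PrimeSpectrum.ext hab)

/-- An element of the characteristic ideal of `M` is divisible by every common divisor of the
determinants of the relation matrices of `M`. -/
theorem dvd_of_mem_charIdeal (hx : Submodule.span R (Set.range x) = ⊤) {g y : R}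
    (hg : ∀ A : Matrix ι ι R, IsRelationMatrix x A → g ∣ A.det) (hy : y ∈ charIdeal R M) :
    g ∣ y := by
  unfold charIdeal at hy
  split_ifs at hy with htor
  · have h := (isTorsion_iff_exists_relationMatrix hx).1 htor
    have hfin := finite_mulSupport_charIdeal hx h
    -- Coprime factors may be treated separately, which leaves prime powers `q ^ k`; there some
    -- matrix attains the local length, forcing `k` to be at most that length.
    induction g using UniqueFactorizationMonoid.induction_on_coprime with
    | h0 =>
      obtain ⟨A, hA, hA0⟩ := h
      exact absurd (zero_dvd_iff.1 (hg A hA)) hA0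
    | h1 hu => exact hu.dvd
    | @hpr q k hq =>
      have hqp : (Ideal.span {q}).IsPrime := (Ideal.span_singleton_prime hq.ne_zero).2 hq
      let p : {p : PrimeSpectrum R // p.asIdeal.height = 1} :=
        ⟨⟨Ideal.span {q}, hqp⟩, Ideal.height_span_singleton_eq_one_of_mem_nonZeroDivisors
          (mem_nonZeroDivisors_of_ne_zero hq.ne_zero) hq.not_isUnit⟩
      obtain ⟨A, hA, hk⟩ := (length_localization_of_relationMatrix (p := p.1.asIdeal)
        hq.ne_zero rfl hx h).2
      have hkl := hk k (hg A hA)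
      have hle : y ∈ p.1.asIdeal ^ (Module.length (Localization.AtPrime p.1.asIdeal)
          (LocalizedModule p.1.asIdeal.primeCompl M)).toNat := by
        rw [finprod_eq_prod _ hfin] at hy
        by_cases hps : p ∈ hfin.toFinset
        · exact Ideal.le_of_dvd (Finset.dvd_prod_of_mem _ hps) hy
        · rw [Set.Finite.mem_toFinset, Function.notMem_mulSupport] at hps
          rw [hps, Ideal.one_eq_top]; trivial
      have := Ideal.pow_le_pow_right hkl hle
      change y ∈ Ideal.span {q} ^ k at this
      rwa [Ideal.span_singleton_pow, Ideal.mem_span_singleton] at this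
    | hcp hrel ha hb =>
      exact hrel.mul_dvd (ha fun A hA => (dvd_mul_right _ _).trans (hg A hA))
        (hb fun A hA => (dvd_mul_left _ _).trans (hg A hA))
  · rw [Submodule.mem_bot] at hy
    rw [hy]
    exact dvd_zero g

/-- The characteristic ideal of a torsion module is generated by a common divisor of the
determinants of the relation matrices. -/
theorem exists_charIdeal_eq_span (hx : Submodule.span R (Set.range x) = ⊤)
    (htor : Module.IsTorsion R M) :
    ∃ f : R, charIdeal R M = Ideal.span {f} ∧
      ∀ A : Matrix ι ι R, IsRelationMatrix x A → f ∣ A.det := by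
  have h := (isTorsion_iff_exists_relationMatrix hx).1 htor
  have hfin := finite_mulSupport_charIdeal hx h
  choose q hq0 hq using fun p => exists_eq_span_of_height_eq_one (R := R) p
  have hprime : ∀ p, Prime (q p) := fun p => prime_of_eq_span (hq0 p) (hq p)
  set l : {p : PrimeSpectrum R // p.asIdeal.height = 1} → ℕ := fun p =>
    (Module.length (Localization.AtPrime p.1.asIdeal)
      (LocalizedModule p.1.asIdeal.primeCompl M)).toNat with hl
  refine ⟨∏ p ∈ hfin.toFinset, q p ^ l p, ?_, fun A hA => ?_⟩
  · unfold charIdeal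
    rw [if_pos htor, finprod_eq_prod _ hfin, ← Ideal.prod_span_singleton]
    refine Finset.prod_congr rfl fun p _ => ?_
    rw [← Ideal.span_singleton_pow, ← hq]
  · refine Finset.prod_dvd_of_isRelPrime (fun p _ p' _ hne => ?_) fun p _ =>
      (length_localization_of_relationMatrix (hq0 p) (hq p) hx h).1 A hA
    refine IsRelPrime.pow ((hprime p).irreducible.isRelPrime_iff_not_dvd.2 fun hdvd => hne ?_)
    refine Subtype.ext (PrimeSpectrum.ext ?_)
    rw [hq, hq, Ideal.span_singleton_eq_span_singleton]
    exact (hprime p).associated_of_dvd (hprime p') hdvd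

end CharIdeal

/-! ### Base change of relation matrices -/

section BaseChange

variable {ι : Type*} [Fintype ι] [DecidableEq ι]

/-- The determinant is linear in each row. The induction enlarges the set `s` of rows that are
allowed to lie in the span rather than in `V` itself. -/
theorem dvd_det_of_rows_mem_span {S : Type*} [CommRing S] {V : Set (ι → S)} {g : S}
    (hV : ∀ A : Matrix ι ι S, (∀ i, A i ∈ V) → g ∣ A.det) (A : Matrix ι ι S)
    (hA : ∀ i, A i ∈ Submodule.span S V) : g ∣ A.det := by
  suffices h : ∀ (s : Finset ι) (A : Matrix ι ι S), (∀ i ∈ s, A i ∈ Submodule.span S V) →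
      (∀ i ∉ s, A i ∈ V) → g ∣ A.det from
    h Finset.univ A (fun i _ => hA i) fun i hi => absurd (Finset.mem_univ i) hi
  intro s
  induction s using Finset.induction_on with
  | empty => exact fun A _ h => hV A fun i => h i (Finset.notMem_empty i)
  | insert i s hi ih =>
    intro A h₁ h₂
    suffices h : ∀ v ∈ Submodule.span S V, g ∣ (A.updateRow i v).det by
      simpa using h (A i) (h₁ i (Finset.mem_insert_self i s))
    intro v hv
    induction hv using Submodule.span_induction with
    | mem v hv =>
      refine ih _ (fun j hj => ?_) fun j hj => ?_
      · rw [Matrix.updateRow_ne (ne_of_mem_of_not_mem hj hi)]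
        exact h₁ j (Finset.mem_insert_of_mem hj)
      · by_cases hji : j = i
        · subst hji; rwa [Matrix.updateRow_self]
        · rw [Matrix.updateRow_ne hji]
          exact h₂ j (by simp [hji, hj])
    | zero =>
      rw [Matrix.det_eq_zero_of_row_eq_zero i fun j => by simp]
      exact dvd_zero g
    | add v w _ _ hv hw => rw [Matrix.det_updateRow_add]; exact dvd_add hv hw
    | smul c v _ hv => rw [Matrix.det_updateRow_smul]; exact hv.mul_left c

/-- By the equational criterion for the vanishing of a tensor, every relation between the `1 ⊗ x j`
is an `S`-linear combination of relations between the `x j`. No flatness is needed. -/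
theorem algebraMap_dvd_det_of_isRelationMatrix_baseChange {R S X : Type*} [CommRing R] [CommRing S]
    [Algebra R S] [AddCommGroup X] [Module R X] {x : ι → X}
    (hx : Submodule.span R (Set.range x) = ⊤) {g : R}
    (hg : ∀ A : Matrix ι ι R, IsRelationMatrix x A → g ∣ A.det) (A : Matrix ι ι S)
    (hA : IsRelationMatrix (fun j => (1 : S) ⊗ₜ[R] x j) A) : algebraMap R S g ∣ A.det := by
  refine dvd_det_of_rows_mem_span
    (V := {w | ∃ v : ι → R, ∑ j, v j • x j = 0 ∧ w = algebraMap R S ∘ v}) ?_ A fun i => ?_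
  · intro A hA
    choose v hv hAv using hA
    have hA' : A = (Matrix.of v).map (algebraMap R S) := by
      ext i j
      rw [hAv i]; rfl
    rw [hA', ← RingHom.mapMatrix_apply, ← RingHom.map_det]
    exact map_dvd _ (hg _ hv)
  · have h1 : ∑ j, x j ⊗ₜ[R] A i j = 0 := by
      have h2 := congrArg (TensorProduct.comm R S X) (hA i)
      simpa [TensorProduct.smul_tmul'] using h2
    obtain ⟨k, a, y, h3, h4⟩ := TensorProduct.vanishesTrivially_of_sum_tmul_eq_zero R hx h1
    have h5 : A i = ∑ l, y l • (algebraMap R S ∘ fun j => a j l) := by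
      ext j
      rw [h3 j, Finset.sum_apply]
      refine Finset.sum_congr rfl fun l _ => ?_
      simp [Algebra.smul_def, mul_comm]
    rw [h5]
    exact sum_mem fun l _ => Submodule.smul_mem _ _ (Submodule.subset_span ⟨_, h4 l, rfl⟩)

end BaseChange

/-! ### Complete local rings of power series -/

section PowerSeriesComplete

open PowerSeries

/-- An element of the maximal ideal has its constant coefficient in the maximal ideal of `R`; its
other terms gain no power there, but each uses up at least one degree. This accounts for the
truncated exponent `n - i`. -/
theorem coeff_mem_pow_of_mem_pow {R : Type*} [CommRing R] [IsLocalRing R] (n : ℕ)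
    {g : PowerSeries R} (hg : g ∈ maximalIdeal (PowerSeries R) ^ n) (i : ℕ) :
    coeff i g ∈ maximalIdeal R ^ (n - i) := by
  induction n generalizing g i with
  | zero => simp
  | succ n ih =>
    rw [pow_succ'] at hg
    induction hg using Submodule.mul_induction_on' with
    | mem_mul_mem a ha b hb =>
      rw [coeff_mul]
      refine sum_mem fun x hx => ?_
      obtain ⟨j, k⟩ := x
      rw [Finset.HasAntidiagonal.mem_antidiagonal] at hx
      dsimp only at hx ⊢
      rcases Nat.eq_zero_or_pos j with rfl | hj
      · have h0 : coeff 0 a ∈ maximalIdeal R := by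
          rw [mem_maximalIdeal, mem_nonunits_iff, isUnit_iff_constantCoeff] at ha
          rwa [coeff_zero_eq_constantCoeff, mem_maximalIdeal, mem_nonunits_iff]
        refine Ideal.pow_le_pow_right (by omega : n + 1 - i ≤ (n - k) + 1) ?_
        rw [pow_succ']
        exact Ideal.mul_mem_mul h0 (ih hb k)
      · exact Ideal.mul_mem_left _ _ (Ideal.pow_le_pow_right (by omega) (ih hb k))
    | add a _ b _ ha hb => rw [map_add]; exact add_mem ha hb

theorem mem_pow_of_coeff_mem_pow {R : Type*} [CommRing R] [IsLocalRing R] (n : ℕ)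
    {g : PowerSeries R} (hg : ∀ i < n, coeff i g ∈ maximalIdeal R ^ (n - i)) :
    g ∈ maximalIdeal (PowerSeries R) ^ n := by
  have hX : (X : PowerSeries R) ∈ maximalIdeal (PowerSeries R) := by
    rw [mem_maximalIdeal, mem_nonunits_iff, isUnit_iff_constantCoeff]
    simp
  have hC : (maximalIdeal R).map (C : R →+* PowerSeries R) ≤ maximalIdeal (PowerSeries R) := by
    rw [Ideal.map_le_iff_le_comap]
    intro a ha
    rw [Ideal.mem_comap, mem_maximalIdeal, mem_nonunits_iff, isUnit_iff_constantCoeff]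
    simpa using ha
  rw [eq_X_pow_mul_shift_add_trunc n g]
  refine add_mem (Ideal.mul_mem_right _ _ (Ideal.pow_mem_pow hX n)) ?_
  have h1 : ((trunc n g : Polynomial R) : PowerSeries R) =
      ∑ i ∈ Finset.Ico 0 n, C (coeff i g) * X ^ i := by
    rw [trunc_apply, ← Polynomial.coeToPowerSeries.ringHom_apply, map_sum]
    simp [PowerSeries.monomial_eq_C_mul_X_pow]
  rw [h1]
  refine sum_mem fun i hi => ?_
  have hin : i < n := (Finset.mem_Ico.1 hi).2
  have h2 : C (coeff i g) ∈ maximalIdeal (PowerSeries R) ^ (n - i) := by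
    refine Ideal.pow_right_mono hC (n - i) ?_
    rw [← Ideal.map_pow]
    exact Ideal.mem_map_of_mem _ (hg i hin)
  have h3 := Ideal.mul_mem_mul h2 (Ideal.pow_mem_pow hX i)
  rwa [← pow_add, Nat.sub_add_cancel hin.le] at h3

theorem isAdicComplete_powerSeries (R : Type*) [CommRing R] [IsLocalRing R] [IsNoetherianRing R]
    [IsAdicComplete (maximalIdeal R) R] :
    IsAdicComplete (maximalIdeal (PowerSeries R)) (PowerSeries R) where
  prec' := by
    intro f hf
    simp only [smul_eq_mul, Ideal.mul_top, SModEq.sub_mem] at hf ⊢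
    -- Limits are taken coefficientwise. The index is shifted by `i` because the coefficient of
    -- degree `i` loses up to `i` powers of the maximal ideal.
    have h1 : ∀ i, ∃ L : R, ∀ k, coeff i (f (k + i)) - L ∈ maximalIdeal R ^ k := fun i => by
      obtain ⟨L, hL⟩ := IsPrecomplete.prec (I := maximalIdeal R) (M := R) inferInstance
        (f := fun k => coeff i (f (k + i))) (by
          intro k k' hk
          simp only [smul_eq_mul, Ideal.mul_top, SModEq.sub_mem]
          have := coeff_mem_pow_of_mem_pow _ (hf (Nat.add_le_add_right hk i)) i
          rwa [map_sub, Nat.add_sub_cancel] at this)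
      simp only [smul_eq_mul, Ideal.mul_top, SModEq.sub_mem] at hL
      exact ⟨L, hL⟩
    choose L hL using h1
    refine ⟨PowerSeries.mk L, fun n => mem_pow_of_coeff_mem_pow n fun i hi => ?_⟩
    have := hL i (n - i)
    rwa [Nat.sub_add_cancel hi.le, ← coeff_mk (R := R) i L, ← map_sub] at this

end PowerSeriesComplete

theorem isAdicComplete_of_ringEquiv {S T : Type*} [CommRing S] [CommRing T] [IsLocalRing S]
    [IsLocalRing T] (e : S ≃+* T) (h : IsAdicComplete (maximalIdeal S) S) :
    IsAdicComplete (maximalIdeal T) T := by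
  have h1 : (maximalIdeal S).map e = maximalIdeal T :=
    eq_maximalIdeal (Ideal.map_isMaximal_of_equiv e)
  rwa [← h1, IsAdicComplete.congr_ringEquiv]

theorem isAdicComplete_mvPowerSeries (n : ℕ) (R : Type*) [CommRing R] [IsLocalRing R]
    [IsNoetherianRing R] (h : IsAdicComplete (maximalIdeal R) R) :
    IsAdicComplete (maximalIdeal (MvPowerSeries (Fin n) R)) (MvPowerSeries (Fin n) R) := by
  induction n with
  | zero =>
    exact isAdicComplete_of_ringEquiv (MvPowerSeries.isEmptyEquiv (Fin 0) R).symm.toRingEquiv h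
  | succ n ih =>
    exact isAdicComplete_of_ringEquiv (MvPowerSeries.finSuccEquiv R n).symm.toRingEquiv
      (isAdicComplete_powerSeries _)

/-- Two ring homomorphisms out of a power series ring which agree on the constants and on the
variable, and send the variable into an ideal for which the target is Hausdorff, agree. -/
theorem powerSeries_ringHom_ext {R S : Type*} [CommRing R] [CommRing S] (J : Ideal S)
    [IsHausdorff J S] {φ ψ : PowerSeries R →+* S}
    (hC : ∀ a, φ (PowerSeries.C a) = ψ (PowerSeries.C a))
    (hX : φ PowerSeries.X = ψ PowerSeries.X) (hJ : φ PowerSeries.X ∈ J) : φ = ψ := by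
  have hpol : (φ.comp (Polynomial.coeToPowerSeries.ringHom)) =
      ψ.comp (Polynomial.coeToPowerSeries.ringHom) := by
    apply Polynomial.ringHom_ext
    · intro a; simpa using hC a
    · simpa using hX
  ext f
  rw [IsHausdorff.eq_iff_smodEq (I := J)]
  intro n
  rw [SModEq.sub_mem, smul_eq_mul, Ideal.mul_top]
  have h1 := PowerSeries.eq_X_pow_mul_shift_add_trunc n f
  rw [h1, map_add, map_add, map_mul, map_mul, map_pow, map_pow, ← hX]
  have h2 : φ ((PowerSeries.trunc n f : Polynomial R) : PowerSeries R) =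
    ψ ((PowerSeries.trunc n f : Polynomial R) : PowerSeries R) := RingHom.congr_fun hpol _
  rw [h2, add_sub_add_right_eq_sub, ← mul_sub]
  exact Ideal.mul_mem_right _ _ (Ideal.pow_mem_pow hJ n)

/-! ### Weierstrass preparation in several variables -/

instance isDomain_mvPowerSeries {σ R : Type*} [CommRing R] [IsDomain R] :
    IsDomain (MvPowerSeries σ R) :=
  NoZeroDivisors.to_isDomain _

section Exponents

variable {O : Type u} [CommRing O] [IsDomain O] [IsDiscreteValuationRing O] {ϖ : O}

theorem residue_eq_zero_iff_dvd (hϖ : Irreducible ϖ) (a : O) : residue O a = 0 ↔ ϖ ∣ a := by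
  rw [residue_eq_zero_iff, hϖ.maximalIdeal_eq, Ideal.mem_span_singleton]

theorem map_residue_eq_zero_iff_dvd {σ : Type*} (hϖ : Irreducible ϖ) (f : MvPowerSeries σ O) :
    f.map (residue O) = 0 ↔ MvPowerSeries.C ϖ ∣ f := by
  constructor
  · intro h
    have h1 : ∀ m, ϖ ∣ MvPowerSeries.coeff m f := fun m => by
      rw [← residue_eq_zero_iff_dvd hϖ, ← MvPowerSeries.coeff_map, h, map_zero]
    choose c hc using h1
    let g : MvPowerSeries σ O := fun m => c m
    have hg : ∀ m, MvPowerSeries.coeff m g = c m := fun _ => rfl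
    refine ⟨g, ?_⟩
    ext m
    rw [hc, MvPowerSeries.coeff_C_mul, hg]
  · rintro ⟨g, rfl⟩
    rw [map_mul, MvPowerSeries.map_C, (residue_eq_zero_iff_dvd hϖ ϖ).2 dvd_rfl, map_zero, zero_mul]

/-- Reduction of the coefficients modulo `ϖ` takes values in power series over a field, which form a
domain. -/
theorem prime_C {σ : Type*} (hϖ : Irreducible ϖ) :
    Prime (MvPowerSeries.C ϖ : MvPowerSeries σ O) := by
  refine ⟨fun h => hϖ.ne_zero (MvPowerSeries.C_injective (h.trans (map_zero _).symm)),
    fun h => hϖ.not_isUnit ?_, fun a b hab => ?_⟩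
  · simpa [MvPowerSeries.isUnit_iff_constantCoeff] using h
  · rw [← map_residue_eq_zero_iff_dvd hϖ, map_mul] at hab
    rw [← map_residue_eq_zero_iff_dvd hϖ, ← map_residue_eq_zero_iff_dvd hϖ]
    exact mul_eq_zero.1 hab

/-- A power series over a commutative ring which is not divisible by the constant `c` is, modulo
`c`, a power of the variable times a power series whose constant coefficient is not divisible by
`c`. -/
theorem exists_eq_add_X_pow_mul {R : Type*} [CommRing R] {c : R} {g : PowerSeries R}
    (hg : ¬ PowerSeries.C c ∣ g) : ∃ (m : ℕ) (a b : PowerSeries R),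
      g = PowerSeries.C c * a + PowerSeries.X ^ m * b ∧ ¬ c ∣ PowerSeries.constantCoeff b := by
  classical
  have h1 : ∃ m, ¬ c ∣ PowerSeries.coeff m g := by
    by_contra! h
    choose a ha using h
    refine hg ⟨PowerSeries.mk a, ?_⟩
    ext m
    rw [PowerSeries.coeff_C_mul, PowerSeries.coeff_mk, ← ha]
  have h2 : ∀ i, ∃ a, i < Nat.find h1 → PowerSeries.coeff i g = c * a := fun i => by
    by_cases hi : i < Nat.find h1
    · obtain ⟨a, ha⟩ := not_not.1 (Nat.find_min h1 hi)
      exact ⟨a, fun _ => ha⟩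
    · exact ⟨0, fun h => absurd h hi⟩
  choose a ha using h2
  refine ⟨Nat.find h1, (PowerSeries.trunc (Nat.find h1) (PowerSeries.mk a) : Polynomial R),
    PowerSeries.mk fun i => PowerSeries.coeff (i + Nat.find h1) g, ?_, ?_⟩
  · conv_lhs => rw [PowerSeries.eq_X_pow_mul_shift_add_trunc (Nat.find h1) g, add_comm]
    congr 1
    ext i
    rw [Polynomial.coeff_coe, PowerSeries.coeff_trunc, PowerSeries.coeff_C_mul,
      Polynomial.coeff_coe, PowerSeries.coeff_trunc, PowerSeries.coeff_mk]
    split_ifs with hi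
    · exact ha i hi
    · rw [mul_zero]
  · rw [← PowerSeries.coeff_zero_eq_constantCoeff_apply, PowerSeries.coeff_mk, zero_add]
    exact Nat.find_spec h1

/-- If `h` is a power series in `n` variables which is not divisible by the uniformizer, then the
value of `h` at a suitable point `(π ^ N₁, …, π ^ Nₙ)` is nonzero, with a bound on its
valuation. -/
theorem exists_exponents (hϖ : Irreducible ϖ) (n : ℕ) (h : MvPowerSeries (Fin n) O)
    (hh : ¬ MvPowerSeries.C ϖ ∣ h) :
    ∃ (N : Fin n → ℕ) (r : ℕ), (∀ i, 0 < N i) ∧ (∀ i : Fin n, (i : ℕ) + 1 = n → N i = 1) ∧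
      (n = 0 → r = 1) ∧ 0 < r ∧
      ∀ (D : Type u) [CommRing D] [IsDomain D] (π : D), π ≠ 0 → ¬ IsUnit π →
        ∀ φ : MvPowerSeries (Fin n) O →+* D, (∀ i, φ (MvPowerSeries.X i) = π ^ N i) →
          π ^ r ∣ φ (MvPowerSeries.C ϖ) → ¬ π ^ r ∣ φ h := by
  -- Two kinds of `φ` are served: reductions killing `ϖ`, and points at which `ϖ` becomes `π ^ r`.
  -- The exponent 1 for the last variable is what the later change of variables requires; it
  -- originates in `r = 1` for `n = 0`.
  induction n with
  | zero =>
    refine ⟨fun _ => 1, 1, fun _ => one_pos, fun _ _ => rfl, fun _ => rfl, one_pos,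
      fun D _ _ π _ hπ φ _ _ hdvd => hπ ?_⟩
    have hu : IsUnit h := by
      have h1 : h = MvPowerSeries.C (MvPowerSeries.constantCoeff h) := by
        ext m
        rw [Subsingleton.elim m 0]
        simp
      rw [MvPowerSeries.isUnit_iff_constantCoeff]
      by_contra hnu
      rw [← mem_nonunits_iff, ← mem_maximalIdeal, hϖ.maximalIdeal_eq,
        Ideal.mem_span_singleton] at hnu
      exact hh (h1 ▸ map_dvd MvPowerSeries.C hnu)
    rw [pow_one] at hdvd
    exact isUnit_of_dvd_unit hdvd (hu.map φ)
  | succ n ih =>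
    let e := MvPowerSeries.finSuccEquiv O n
    have heC : ∀ a, e.symm (PowerSeries.C (MvPowerSeries.C a)) = MvPowerSeries.C a := fun a => by
      rw [AlgEquiv.symm_apply_eq, MvPowerSeries.finSuccEquiv_C]
    have heX : e.symm PowerSeries.X = MvPowerSeries.X 0 := by
      rw [AlgEquiv.symm_apply_eq, MvPowerSeries.finSuccEquiv_X_zero]
    have heX' : ∀ i, e.symm (PowerSeries.C (MvPowerSeries.X i)) = MvPowerSeries.X i.succ :=
      fun i => by rw [AlgEquiv.symm_apply_eq, MvPowerSeries.finSuccEquiv_X_succ]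
    have hg : ¬ PowerSeries.C (MvPowerSeries.C ϖ) ∣ e h := fun hd => hh (by
      have := map_dvd e.symm hd
      rwa [heC, AlgEquiv.symm_apply_apply] at this)
    obtain ⟨m, a, b, hab, hb⟩ := exists_eq_add_X_pow_mul hg
    obtain ⟨N, r, hN, hlast, hr0, hr, key⟩ := ih _ hb
    -- Sending the first variable to `π ^ r` keeps `b` congruent to its constant coefficient modulo
    -- `π ^ r`, so its value is still not divisible by `π ^ r`. The factor `X ^ m` contributes `π ^
    -- (r * m)`.
    refine ⟨Fin.cons r N, r * m + r, ?_, ?_, by omega, by omega, ?_⟩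
    · intro i
      refine Fin.cases ?_ (fun i => ?_) i
      · simpa using hr
      · simpa using hN i
    · intro i
      refine Fin.cases (fun h0 => ?_) (fun i hi => ?_) i
      · simpa using hr0 (by simpa using h0.symm)
      · simpa using hlast i (by simpa using hi)
    · intro D _ _ π hπ0 hπ φ hφ hdvd hdvd'
      let ψ : PowerSeries (MvPowerSeries (Fin n) O) →+* D := φ.comp e.symm.toRingEquiv.toRingHom
      have hψC : ψ (PowerSeries.C (MvPowerSeries.C ϖ)) = φ (MvPowerSeries.C ϖ) :=
        congrArg φ (heC ϖ)
      have hψX : ψ PowerSeries.X = π ^ r := (congrArg φ heX).trans (by simpa using hφ 0)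
      have hφh : φ h = ψ (e h) := congrArg φ (e.symm_apply_apply h).symm
      have h1 : ¬ π ^ r ∣ (ψ.comp PowerSeries.C) (PowerSeries.constantCoeff b) := by
        refine key D π hπ0 hπ _ (fun i => ?_) ?_
        · have := hφ i.succ
          rw [Fin.cons_succ] at this
          rw [← this]
          exact congrArg φ (heX' i)
        · exact (pow_dvd_pow π (by omega : r ≤ r * m + r)).trans (hψC ▸ hdvd)
      have h2 : b = PowerSeries.C (PowerSeries.constantCoeff b) +
          PowerSeries.X * PowerSeries.mk fun p => PowerSeries.coeff (p + 1) b := by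
        rw [add_comm]; exact PowerSeries.eq_X_mul_shift_add_const b
      have h3 : ¬ π ^ r ∣ ψ b := fun hd => h1 (by
        rw [h2, map_add, map_mul, hψX] at hd
        exact (dvd_add_left (dvd_mul_right _ _)).1 hd)
      rw [hφh, hab, map_add, map_mul, hψC, map_mul, map_pow, hψX] at hdvd'
      rw [dvd_add_right (hdvd.mul_right _), pow_add, ← pow_mul,
        mul_dvd_mul_iff_left (pow_ne_zero _ hπ0)] at hdvd'
      exact h3 hdvd'

end Exponents

/-! ### Changes of variables making a power series regular -/

section Regularization

variable {R : Type u} [CommRing R]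

theorem hasSubst_shear (n : ℕ) {N : Fin (n + 1) → ℕ} (hN : ∀ i, 0 < N i) :
    MvPowerSeries.HasSubst (S := R) fun i : Fin (n + 1) =>
      MvPowerSeries.X i.rev + if i = Fin.last n then 0 else MvPowerSeries.X 0 ^ N i :=
  MvPowerSeries.hasSubst_of_constantCoeff_zero fun i => by
    split_ifs
    · simp
    · simp [(hN i).ne']

theorem hasSubst_shear_symm (n : ℕ) {N : Fin (n + 1) → ℕ} (hN : ∀ i, 0 < N i) :
    MvPowerSeries.HasSubst (S := R) fun i : Fin (n + 1) =>
      MvPowerSeries.X i.rev - if i = 0 then 0 else MvPowerSeries.X (Fin.last n) ^ N i.rev :=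
  MvPowerSeries.hasSubst_of_constantCoeff_zero fun i => by
    split_ifs
    · simp
    · simp [(hN i.rev).ne']

/-- The automorphism of `R⟦X₀, …, Xₙ⟧` which reverses the order of the variables and then maps
`Xᵢ` to `Xᵢ + X₀ ^ N` for all `i ≠ 0` (with an exponent `N` depending on `i`). -/
def shearEquiv (n : ℕ) (N : Fin (n + 1) → ℕ) (hN : ∀ i, 0 < N i) :
    MvPowerSeries (Fin (n + 1)) R ≃ₐ[R] MvPowerSeries (Fin (n + 1)) R :=
  have ha := hasSubst_shear (R := R) n hN
  have hb := hasSubst_shear_symm (R := R) n hN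
  AlgEquiv.ofAlgHom (MvPowerSeries.substAlgHom ha) (MvPowerSeries.substAlgHom hb)
    (by
      ext1 f
      rw [AlgHom.comp_apply, MvPowerSeries.substAlgHom_apply hb, MvPowerSeries.substAlgHom_apply ha,
        MvPowerSeries.subst_comp_subst_apply hb ha, AlgHom.id_apply]
      conv_rhs => rw [← id_def f, ← MvPowerSeries.subst_self (R := R)]
      congr 1
      funext j
      -- The last variable maps to `X₀` without correction, so the subtracted power becomes a power
      -- of `X₀` and cancels the added one.
      rw [← MvPowerSeries.substAlgHom_apply ha, map_sub, MvPowerSeries.substAlgHom_X ha,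
        Fin.rev_rev]
      by_cases hj : j = 0
      · subst hj
        rw [if_pos rfl, map_zero]
        simp
      · have : j.rev ≠ Fin.last n := fun h => hj (by rw [← Fin.rev_rev j, h, Fin.rev_last])
        rw [if_neg hj, if_neg this, map_pow, MvPowerSeries.substAlgHom_X ha]
        simp)
    (by
      ext1 f
      rw [AlgHom.comp_apply, MvPowerSeries.substAlgHom_apply hb, MvPowerSeries.substAlgHom_apply ha,
        MvPowerSeries.subst_comp_subst_apply ha hb, AlgHom.id_apply]
      conv_rhs => rw [← id_def f, ← MvPowerSeries.subst_self (R := R)]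
      congr 1
      funext i
      rw [← MvPowerSeries.substAlgHom_apply hb, map_add, MvPowerSeries.substAlgHom_X hb,
        Fin.rev_rev]
      by_cases hi : i = Fin.last n
      · subst hi
        rw [if_pos rfl, map_zero]
        simp
      · have : i.rev ≠ 0 := fun h => hi (by rw [← Fin.rev_rev i, h, Fin.rev_zero])
        rw [if_neg hi, if_neg this, map_pow, MvPowerSeries.substAlgHom_X hb]
        simp)

theorem shearEquiv_X (n : ℕ) (N : Fin (n + 1) → ℕ) (hN : ∀ i, 0 < N i) (i : Fin (n + 1)) :
    shearEquiv (R := R) n N hN (MvPowerSeries.X i) =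
      MvPowerSeries.X i.rev + if i = Fin.last n then 0 else MvPowerSeries.X 0 ^ N i :=
  MvPowerSeries.substAlgHom_X (hasSubst_shear n hN) i

/-- A power series over a discrete valuation ring which is not divisible by the uniformizer is
regular with respect to the first variable after an automorphism. -/
theorem exists_algEquiv_map_residue_ne_zero {O : Type u} [CommRing O] [IsDomain O]
    [IsDiscreteValuationRing O] {ϖ : O} (hϖ : Irreducible ϖ) (n : ℕ)
    (h : MvPowerSeries (Fin (n + 1)) O) (hh : ¬ MvPowerSeries.C ϖ ∣ h) :
    ∃ e : MvPowerSeries (Fin (n + 1)) O ≃ₐ[O] PowerSeries (MvPowerSeries (Fin n) O),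
      (e h).map (residue (MvPowerSeries (Fin n) O)) ≠ 0 := by
  obtain ⟨N, r, hN, hlast, -, -, key⟩ := exists_exponents hϖ (n + 1) h hh
  let e := (shearEquiv (R := O) n N hN).trans (MvPowerSeries.finSuccEquiv O n)
  refine ⟨e, fun h0 => ?_⟩
  let S := MvPowerSeries (Fin n) O
  let φ : MvPowerSeries (Fin (n + 1)) O →+* PowerSeries (ResidueField S) :=
    (PowerSeries.map (residue S)).comp e.toRingEquiv.toRingHom
  have hXS : ∀ i, residue S (MvPowerSeries.X i) = 0 := fun i => by
    rw [residue_eq_zero_iff, mem_maximalIdeal, mem_nonunits_iff,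
      MvPowerSeries.isUnit_iff_constantCoeff]
    simp
  -- `φ` restricts the reduction of a series to the curve whose coordinates are the powers `X ^ N
  -- i`. It kills `ϖ`, so by the choice of `N` it cannot kill `h`.
  refine key _ (PowerSeries.X : PowerSeries (ResidueField S)) PowerSeries.X_ne_zero
    PowerSeries.X_prime.not_isUnit φ (fun i => ?_) ?_ ?_
  · change PowerSeries.map (residue S) (MvPowerSeries.finSuccEquiv O n
      (shearEquiv n N hN (MvPowerSeries.X i))) = _
    rw [shearEquiv_X]
    split_ifs with hi
    · subst hi
      rw [hlast _ (by simp), pow_one, Fin.rev_last, add_zero, MvPowerSeries.finSuccEquiv_X_zero,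
        PowerSeries.map_X]
    · obtain ⟨j, hj⟩ := Fin.exists_succ_eq.2 (fun h : i.rev = 0 => hi (by
        rw [← Fin.rev_rev i, h, Fin.rev_zero]))
      rw [← hj, map_add, map_pow, MvPowerSeries.finSuccEquiv_X_zero,
        MvPowerSeries.finSuccEquiv_X_succ, map_add, map_pow, PowerSeries.map_X, PowerSeries.map_C,
        hXS, map_zero, zero_add]
  · have : φ (MvPowerSeries.C ϖ) = 0 := by
      have h1 : shearEquiv (R := O) n N hN (MvPowerSeries.C ϖ) = MvPowerSeries.C ϖ :=
        (shearEquiv (R := O) n N hN).commutes ϖ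
      change PowerSeries.map (residue S) (MvPowerSeries.finSuccEquiv O n
        (shearEquiv n N hN (MvPowerSeries.C ϖ))) = 0
      rw [h1, MvPowerSeries.finSuccEquiv_C]
      have : residue S (MvPowerSeries.C ϖ) = 0 := by
        rw [residue_eq_zero_iff, mem_maximalIdeal, mem_nonunits_iff]
        exact (prime_C hϖ).not_isUnit
      rw [PowerSeries.map_C, this, map_zero]
    rw [this]
    exact dvd_zero _
  · have : φ h = 0 := h0
    rw [this]
    exact dvd_zero _

end Regularization

/-! ### Factoriality of power series rings -/

section UniqueFactorization

/-- Modulo `m`, the polynomial `G` is a monic divisor of a power of the variable, hence itself such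
a power. -/
theorem isDistinguishedAt_of_monic_of_dvd {R : Type*} [CommRing R] {m : Ideal R}
    [m.IsMaximal] {G F : Polynomial R} (hG : G.Monic) (hF : F.IsDistinguishedAt m) (h : G ∣ F) :
    G.IsDistinguishedAt m := by
  refine ⟨⟨fun {i} hi => ?_⟩, hG⟩
  let _ : Field (R ⧸ m) := Ideal.Quotient.field m
  have h1 : G.map (Ideal.Quotient.mk m) ∣ Polynomial.X ^ F.natDegree := by
    rw [← hF.map_eq_X_pow]
    exact Polynomial.map_dvd _ h
  obtain ⟨a, -, ha⟩ := (dvd_prime_pow Polynomial.prime_X _).1 h1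
  have h2 := Polynomial.eq_of_monic_of_associated (hG.map _) (Polynomial.monic_X_pow a) ha
  have h3 : G.natDegree = a := by
    rw [← hG.natDegree_map (Ideal.Quotient.mk m), h2, Polynomial.natDegree_X_pow]
  rw [← Ideal.Quotient.eq_zero_iff_mem, ← Polynomial.coeff_map, h2, Polynomial.coeff_X_pow,
    if_neg (by omega)]

/-- Over a complete local ring, the distinguished polynomials which are prime in the polynomial
ring are prime in the power series ring. -/
theorem prime_coe_of_isDistinguishedAt {R : Type*} [CommRing R] [IsDomain R] [IsLocalRing R]
    [IsAdicComplete (maximalIdeal R) R] {G : Polynomial R}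
    (hG : G.IsDistinguishedAt (maximalIdeal R)) (hp : Prime G) : Prime (G : PowerSeries R) := by
  have h0 : (G : PowerSeries R) ≠ 0 := by
    rw [Ne, ← Polynomial.coe_zero, Polynomial.coe_inj]
    exact hp.ne_zero
  rw [← Ideal.span_singleton_prime h0, ← Ideal.Quotient.isDomain_iff_prime]
  have : IsDomain (Polynomial R ⧸ Ideal.span {G}) :=
    (Ideal.Quotient.isDomain_iff_prime _).2 ((Ideal.span_singleton_prime hp.ne_zero).2 hp)
  -- Weierstrass division identifies the quotients of the polynomial ring and of the power series
  -- ring by `G`.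
  exact hG.algEquivQuotient.symm.toMulEquiv.isDomain _

/-- Over a complete local factorial ring, a prime ideal of the power series ring which contains a
distinguished polynomial contains a prime element. -/
theorem exists_prime_mem_of_isDistinguishedAt_mem {R : Type*} [CommRing R] [IsDomain R]
    [IsLocalRing R] [UniqueFactorizationMonoid R] [IsAdicComplete (maximalIdeal R) R]
    (P : Ideal (PowerSeries R)) [P.IsPrime] {F : Polynomial R}
    (hF : F.IsDistinguishedAt (maximalIdeal R)) (hFP : (F : PowerSeries R) ∈ P) :
    ∃ g ∈ P, Prime g := by
  obtain ⟨s, hs, u, hsu⟩ := UniqueFactorizationMonoid.exists_prime_factors F hF.monic.ne_zero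
  have hsP : s.prod ∈ P.comap (Polynomial.coeToPowerSeries.ringHom (R := R)) := by
    have h1 : s.prod * ↑u ∈ P.comap (Polynomial.coeToPowerSeries.ringHom (R := R)) := by
      rw [hsu]; exact hFP
    exact ((Ideal.IsPrime.comap Polynomial.coeToPowerSeries.ringHom).mem_or_mem h1).resolve_right
      fun h => (Ideal.IsPrime.comap Polynomial.coeToPowerSeries.ringHom).ne_top
        (Ideal.eq_top_of_isUnit_mem _ h u.isUnit)
  obtain ⟨G, hGs, hGP⟩ := (Ideal.IsPrime.multiset_prod_mem_iff_exists_mem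
    (Ideal.IsPrime.comap Polynomial.coeToPowerSeries.ringHom) s).1 hsP
  obtain ⟨H, hH⟩ : G ∣ F := (Multiset.dvd_prod hGs).trans ⟨u, hsu.symm⟩
  -- A prime factor of the monic `F` has a unit leading coefficient, so it can be normalized to be
  -- monic, and is then distinguished.
  have hlc : G.leadingCoeff * H.leadingCoeff = 1 := by
    rw [← Polynomial.leadingCoeff_mul, ← hH, hF.monic.leadingCoeff]
  have hu : IsUnit (Polynomial.C H.leadingCoeff) :=
    (IsUnit.of_mul_eq_one _ (by rw [mul_comm, hlc])).map Polynomial.C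
  have hass : Associated G (G * Polynomial.C H.leadingCoeff) :=
    associated_mul_unit_right _ _ hu
  have hmonic : (G * Polynomial.C H.leadingCoeff).Monic := by
    rw [Polynomial.Monic, Polynomial.leadingCoeff_mul, Polynomial.leadingCoeff_C, hlc]
  refine ⟨_, ?_, prime_coe_of_isDistinguishedAt (isDistinguishedAt_of_monic_of_dvd hmonic hF
    (hass.symm.dvd.trans ⟨H, hH⟩)) (hass.prime (hs G hGs))⟩
  rw [Polynomial.coe_mul]
  exact P.mul_mem_right _ hGP

/-- Kaplansky's criterion: every nonzero prime ideal must contain a prime element. If `ϖ` is not in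
the ideal, dividing out its powers and applying Weierstrass preparation produce a distinguished
polynomial in the ideal, up to an automorphism; its factorization in the polynomial ring over one
variable fewer supplies the prime. -/
theorem uniqueFactorizationMonoid_mvPowerSeries (O : Type u) [CommRing O] [IsDomain O]
    [IsDiscreteValuationRing O] [IsAdicComplete (maximalIdeal O) O] (n : ℕ) :
    UniqueFactorizationMonoid (MvPowerSeries (Fin n) O) := by
  induction n with
  | zero =>
    exact (MvPowerSeries.isEmptyEquiv (Fin 0) O).symm.toMulEquiv.uniqueFactorizationMonoid
      inferInstance
  | succ n ih =>
    have := isAdicComplete_mvPowerSeries n O inferInstance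
    obtain ⟨ϖ, hϖ⟩ := IsDiscreteValuationRing.exists_irreducible O
    refine UniqueFactorizationMonoid.iff_exists_prime_mem_of_isPrime.2 fun P hP0 hP => ?_
    by_cases hϖP : MvPowerSeries.C ϖ ∈ P
    · exact ⟨_, hϖP, prime_C hϖ⟩
    obtain ⟨f, hfP, hf0⟩ := Submodule.exists_mem_ne_zero_of_ne_bot hP0
    obtain ⟨k, g, hg, hfg⟩ := WfDvdMonoid.max_power_factor hf0 (prime_C (σ := Fin (n + 1)) hϖ).irreducible
    have hgP : g ∈ P := by
      rw [hfg] at hfP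
      exact (hP.mem_or_mem hfP).resolve_left fun h => hϖP (hP.mem_of_pow_mem _ h)
    obtain ⟨e, he⟩ := exists_algEquiv_map_residue_ne_zero hϖ n g hg
    obtain ⟨F, u, hFu⟩ := PowerSeries.exists_isWeierstrassFactorization he
    let P' : Ideal (PowerSeries (MvPowerSeries (Fin n) O)) :=
      P.comap e.symm.toRingEquiv.toRingHom
    have hP' : P'.IsPrime := Ideal.IsPrime.comap _
    have hFP' : (F : PowerSeries (MvPowerSeries (Fin n) O)) ∈ P' := by
      have h1 : e g ∈ P' := by
        change e.symm (e g) ∈ P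
        rwa [e.symm_apply_apply]
      rw [hFu.eq_mul] at h1
      exact (hP'.mem_or_mem h1).resolve_right fun h =>
        hP'.ne_top (Ideal.eq_top_of_isUnit_mem _ h hFu.isUnit)
    obtain ⟨x, hxP, hx⟩ := exists_prime_mem_of_isDistinguishedAt_mem P' hFu.isDistinguishedAt hFP'
    exact ⟨e.symm x, hxP, (MulEquiv.prime_iff e.symm.toMulEquiv).2 hx⟩

end UniqueFactorization

/-! ### Finite extensions of complete discrete valuation rings -/

theorem isAdicComplete_map_of_finite (R S : Type u) [CommRing R] [IsNoetherianRing R] (I : Ideal R)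
    [IsAdicComplete I R] [CommRing S] [Algebra R S] [Module.Finite R S] :
    IsAdicComplete (I.map (algebraMap R S)) S := by
  rw [IsAdicComplete.map_algebraMap_iff, ← AdicCompletion.of_bijective_iff]
  have hb := AdicCompletion.ofTensorProduct_bijective_of_finite_of_isNoetherian I S
  let e : S ≃ₗ[R] AdicCompletion I R ⊗[R] S :=
    (TensorProduct.lid R S).symm ≪≫ₗ
      TensorProduct.congr (AdicCompletion.ofLinearEquiv I R) (LinearEquiv.refl R S)
  have : (AdicCompletion.of I S : S → AdicCompletion I S) =
      AdicCompletion.ofTensorProduct I S ∘ e := by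
    ext x n
    have h1 : e x = 1 ⊗ₜ x := rfl
    rw [Function.comp_apply, h1, AdicCompletion.ofTensorProduct_tmul, one_smul]
  rw [this]
  exact hb.comp e.bijective

/-- The chain of ideals generated by powers of `x` stabilizes, so `x ^ n = x ^ (2 * n) * y` for some
`n`; then `x ^ n * y` is idempotent. -/
theorem exists_idempotent_of_isArtinianRing {A : Type*} [CommRing A] [IsArtinianRing A]
    (x : A) : ∃ (n : ℕ) (e : A), e * e = e ∧ x ^ n * e = x ^ n ∧ x ∣ e := by
  obtain ⟨n, hn⟩ := IsArtinian.monotone_stabilizes (R := A) (M := A)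
    ⟨fun n => OrderDual.toDual (Ideal.span {x ^ n} : Ideal A), fun i j hij => by
      exact Ideal.span_singleton_le_span_singleton.2 (pow_dvd_pow x hij)⟩
  have h1 : (Ideal.span {x ^ (n + 1)} : Ideal A) = Ideal.span {x ^ (n + 1 + (n + 1))} :=
    (hn (n + 1) (by omega)).symm.trans (hn (n + 1 + (n + 1)) (by omega))
  have h2 : x ^ (n + 1) ∈ Ideal.span {x ^ (n + 1 + (n + 1))} := h1 ▸ Ideal.mem_span_singleton_self _
  obtain ⟨y, hy⟩ := Ideal.mem_span_singleton.1 h2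
  have h3 : x ^ (n + 1) * (x ^ (n + 1) * y) = x ^ (n + 1) := by rw [← mul_assoc, ← pow_add, ← hy]
  refine ⟨n + 1, x ^ (n + 1) * y, ?_, h3, (dvd_pow_self x n.succ_ne_zero).mul_right y⟩
  calc x ^ (n + 1) * y * (x ^ (n + 1) * y) = x ^ (n + 1) * (x ^ (n + 1) * y) * y := by ring
    _ = x ^ (n + 1) * y := by rw [h3]

/-- A domain which is finite over a complete Noetherian local ring is local. -/
theorem isLocalRing_of_finite (R S : Type u) [CommRing R] [IsLocalRing R] [IsNoetherianRing R]
    [IsAdicComplete (maximalIdeal R) R] [CommRing S] [IsDomain S] [Algebra R S]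
    [Module.Finite R S] : IsLocalRing S := by
  set J := (maximalIdeal R).map (algebraMap R S) with hJ
  have hcomp : IsAdicComplete J S := isAdicComplete_map_of_finite R S (maximalIdeal R)
  have hle : ∀ M : Ideal S, M.IsMaximal → J ≤ M := fun M hM => by
    rw [hJ, Ideal.map_le_iff_le_comap]
    have : (M.comap (algebraMap R S)).IsMaximal :=
      Ideal.isMaximal_comap_of_isIntegral_of_isMaximal _
    rw [eq_maximalIdeal this]
  have : IsArtinianRing (S ⧸ J) := by
    let _ : Field (R ⧸ maximalIdeal R) := Ideal.Quotient.field _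
    have : Module.Finite (R ⧸ maximalIdeal R) (S ⧸ J) :=
      Module.Finite.of_restrictScalars_finite R _ _
    exact IsArtinianRing.of_finite (R ⧸ maximalIdeal R) _
  refine IsLocalRing.of_unique_max_ideal ?_
  -- Two maximal ideals would give an idempotent modulo `J` lying in one and not in the other.
  -- Hensel's lemma lifts it to a root of `X ^ 2 - X` in the domain `S`, that is, to 0 or 1, and
  -- neither is possible.
  obtain ⟨M, hM⟩ := Ideal.exists_maximal S
  refine ⟨M, hM, fun M' hM' => ?_⟩
  by_contra hne
  obtain ⟨x, hxM', hxM⟩ := SetLike.not_le_iff_exists.1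
    (fun h : M' ≤ M => hne (hM'.eq_of_le hM.ne_top h))
  obtain ⟨n, e, hee, hxe, hdvd⟩ :=
    exists_idempotent_of_isArtinianRing (Ideal.Quotient.mk J x)
  obtain ⟨e, rfl⟩ := Ideal.Quotient.mk_surjective e
  rw [← map_mul, Ideal.Quotient.eq] at hee
  rw [← map_pow, ← map_mul, Ideal.Quotient.eq] at hxe
  have heM : e ∉ M := fun h => hxM (hM.isPrime.mem_of_pow_mem n (by
    have := sub_mem (M.mul_mem_left (x ^ n) h) (hle M hM hxe)
    rwa [sub_sub_cancel] at this))
  obtain ⟨a, ha, hae⟩ := HenselianRing.is_henselian (I := J)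
    (Polynomial.X ^ 2 - Polynomial.X : Polynomial S)
    (Polynomial.monic_X_pow_sub (by rw [Polynomial.degree_X]; norm_num)) e
    (by simpa [sq] using hee)
    (by
      -- The derivative `2 * e - 1` is its own inverse, since its square is `1 + 4 * (e * e - e)`.
      refine IsUnit.of_mul_eq_one (Ideal.Quotient.mk J (2 * e - 1)) ?_
      rw [← map_mul, ← map_one (Ideal.Quotient.mk J), Ideal.Quotient.eq]
      simp only [Polynomial.derivative_sub, Polynomial.derivative_X_pow, Polynomial.derivative_X,
        Polynomial.eval_sub, Polynomial.eval_mul, Polynomial.eval_pow, Polynomial.eval_X,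
        Polynomial.eval_one]
      have h4 : (4 : S) * (e * e - e) ∈ J := J.mul_mem_left _ hee
      convert! h4 using 1
      simp
      ring)
  have ha' : a * (a - 1) = 0 := by
    have : a ^ 2 - a = 0 := by simpa using ha
    linear_combination this
  rcases mul_eq_zero.1 ha' with h0 | h1
  · rw [h0, zero_sub, neg_mem_iff] at hae
    exact heM (hle M hM hae)
  · rw [sub_eq_zero.1 h1] at hae
    obtain ⟨c, hc⟩ := hdvd
    obtain ⟨c, rfl⟩ := Ideal.Quotient.mk_surjective c
    rw [← map_mul, Ideal.Quotient.eq] at hc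
    have heM' : e ∈ M' := by
      have := add_mem (hle M' hM' hc) (M'.mul_mem_right c hxM')
      rwa [sub_add_cancel] at this
    have := add_mem (hle M' hM' hae) heM'
    rw [sub_add_cancel] at this
    exact hM'.ne_top ((Ideal.eq_top_iff_one _).2 this)

/-- A monic polynomial over a complete discrete valuation ring of characteristic zero splits into
linear factors over a finite extension. -/
theorem exists_finite_extension_splits (O : Type u) [CommRing O] [IsDomain O]
    [IsDiscreteValuationRing O] [IsAdicComplete (maximalIdeal O) O] [CharZero O]
    {P : Polynomial O} (hP : P.Monic) :
    ∃ (O' : Type u) (_ : CommRing O') (_ : IsDomain O') (_ : IsDiscreteValuationRing O')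
      (_ : Algebra O O') (_ : FaithfulSMul O O') (_ : Module.Finite O O') (s : Multiset O'),
      P.map (algebraMap O O') = (s.map fun a => Polynomial.X - Polynomial.C a).prod := by
  let K := FractionRing O
  have : CharZero K := charZero_of_injective_algebraMap (IsFractionRing.injective O K)
  let L := (P.map (algebraMap O K)).SplittingField
  have hinj : Function.Injective (algebraMap O L) := by
    rw [IsScalarTower.algebraMap_eq O K L]
    exact (algebraMap K L).injective.comp (IsFractionRing.injective O K)
  -- The integral closure in the splitting field: finite by separability in characteristic zero,
  -- Dedekind, and local by completeness. It contains the roots because `P` is monic.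
  let O' := integralClosure O L
  have hfin : Module.Finite O O' := IsIntegralClosure.finite O K L O'
  have hded : IsDedekindDomain O' := integralClosure.isDedekindDomain O K L
  have hfaith : FaithfulSMul O O' := by
    rw [faithfulSMul_iff_algebraMap_injective]
    intro a b hab
    exact hinj (congrArg (algebraMap O' L) hab)
  have hloc : IsLocalRing O' := isLocalRing_of_finite O O'
  have hnf : ¬ IsField O' := fun h => IsDiscreteValuationRing.not_isField O
    (isField_of_isIntegral_of_isField (FaithfulSMul.algebraMap_injective O O') h)
  have hdvr : IsDiscreteValuationRing O' :=
    ((IsDiscreteValuationRing.TFAE O' hnf).out 0 2 : _ ↔ IsDedekindDomain O').2 hded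
  refine ⟨O', inferInstance, inferInstance, hdvr, inferInstance, hfaith, hfin, ?_⟩
  have hsplit := Polynomial.SplittingField.splits (P.map (algebraMap O K))
  have hPL : (P.map (algebraMap O K)).map (algebraMap K L) = P.map (algebraMap O L) := by
    rw [Polynomial.map_map, ← IsScalarTower.algebraMap_eq]
  have hprod : P.map (algebraMap O L) =
      ((P.map (algebraMap O L)).roots.map fun a => Polynomial.X - Polynomial.C a).prod := by
    rw [hPL] at hsplit
    exact hsplit.eq_prod_roots_of_monic (hP.map _)
  have hint : ∀ a ∈ (P.map (algebraMap O L)).roots, a ∈ O' := fun a ha => by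
    refine ⟨P, hP, ?_⟩
    rw [← Polynomial.eval_map]
    exact (Polynomial.mem_roots'.1 ha).2
  refine ⟨(P.map (algebraMap O L)).roots.pmap (fun a ha => ⟨a, ha⟩) hint, ?_⟩
  apply Polynomial.map_injective (algebraMap O' L) (Subtype.val_injective)
  rw [Polynomial.map_map, ← IsScalarTower.algebraMap_eq, Polynomial.map_multiset_prod,
    Multiset.map_map]
  refine hprod.trans (congrArg Multiset.prod ?_)
  rw [Multiset.map_pmap]
  exact ((Multiset.pmap_eq_map _ _ _ hint).symm.trans
    (Multiset.pmap_congr _ fun a _ _ _ => by simp))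

/-! ### Points of the formal polydisc -/

section Points

theorem dvd_of_forall_pow_dvd {D : Type*} [CommRing D] [IsDomain D] [IsDiscreteValuationRing D]
    {ϖ : D} (hϖ : Irreducible ϖ) {a b : D} (h : ∀ k, ϖ ^ k ∣ a → ϖ ^ k ∣ b) : a ∣ b := by
  by_cases ha : a = 0
  · by_contra hb
    have hb0 : b ≠ 0 := fun h0 => hb (h0 ▸ dvd_zero a)
    obtain ⟨k, hk⟩ := IsDiscreteValuationRing.associated_pow_irreducible hb0 hϖ
    have h1 := (h (k + 1) (ha ▸ dvd_zero _)).trans hk.dvd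
    have := (pow_dvd_pow_iff hϖ.ne_zero hϖ.not_isUnit).1 h1
    omega
  · obtain ⟨k, hk⟩ := IsDiscreteValuationRing.associated_pow_irreducible ha hϖ
    exact hk.dvd.trans (h k hk.symm.dvd)

/-- Roots are removed one at a time, so multiplicities need no separate argument. Cancelling `β - a`
loses the point `β = a`, which is recovered by continuity. -/
theorem prod_X_sub_C_dvd_of_forall_eval_dvd {D : Type*} [CommRing D] [IsDomain D]
    [IsDiscreteValuationRing D] (s : Multiset D) (hs : ∀ a ∈ s, a ∈ maximalIdeal D)
    (r : Polynomial D)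
    (h : ∀ β ∈ maximalIdeal D,
      ((s.map fun a => Polynomial.X - Polynomial.C a).prod).eval β ∣ r.eval β) :
    (s.map fun a => Polynomial.X - Polynomial.C a).prod ∣ r := by
  obtain ⟨ϖ, hϖ⟩ := IsDiscreteValuationRing.exists_irreducible D
  induction s using Multiset.induction_on generalizing r with
  | empty => simp
  | cons a s ih =>
    simp only [Multiset.map_cons, Multiset.prod_cons, Polynomial.eval_mul, Polynomial.eval_sub,
      Polynomial.eval_X, Polynomial.eval_C] at h ⊢
    have ha : a ∈ maximalIdeal D := hs a (Multiset.mem_cons_self a s)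
    obtain ⟨r, rfl⟩ : Polynomial.X - Polynomial.C a ∣ r := by
      rw [Polynomial.dvd_iff_isRoot]
      have := h a ha
      rwa [sub_self, zero_mul, zero_dvd_iff] at this
    set F := (s.map fun a => Polynomial.X - Polynomial.C a).prod with hF
    refine mul_dvd_mul_left _ (ih (fun b hb => hs b (Multiset.mem_cons_of_mem hb)) r ?_)
    simp only [Polynomial.eval_mul, Polynomial.eval_sub, Polynomial.eval_X,
      Polynomial.eval_C] at h
    have h1 : ∀ β ∈ maximalIdeal D, β ≠ a → F.eval β ∣ r.eval β := fun β hβ hne =>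
      (mul_dvd_mul_iff_left (sub_ne_zero.2 hne)).1 (h β hβ)
    intro β hβ
    by_cases hne : β = a
    · subst hne
      refine dvd_of_forall_pow_dvd hϖ fun k hk => ?_
      -- A nearby point different from `β`; the exponent `k + 1` keeps it in the maximal ideal even
      -- for `k = 0`.
      have hmem : β + ϖ ^ (k + 1) ∈ maximalIdeal D := by
        refine add_mem hβ ?_
        rw [hϖ.maximalIdeal_eq, Ideal.mem_span_singleton]
        exact dvd_pow_self ϖ k.succ_ne_zero
      have h2 := h1 _ hmem (by simp [hϖ.ne_zero])
      have h3 : ∀ p : Polynomial D, ϖ ^ k ∣ p.eval (β + ϖ ^ (k + 1)) - p.eval β := fun p => by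
        refine (pow_dvd_pow ϖ k.le_succ).trans ?_
        have := Polynomial.sub_dvd_eval_sub (β + ϖ ^ (k + 1)) β p
        rwa [add_sub_cancel_left] at this
      have h4 := ((dvd_iff_dvd_of_dvd_sub (h3 F)).2 hk).trans h2
      exact (dvd_iff_dvd_of_dvd_sub (h3 r)).1 h4
    · exact h1 β hβ hne

/-- Evaluation of power series at a point with coordinates in the maximal ideal. -/
theorem exists_algHom_mvPowerSeries {n : ℕ} (R S : Type*) [CommRing R] [CommRing S] [IsLocalRing S]
    [IsAdicComplete (maximalIdeal S) S] [Algebra R S] (x : Fin n → S)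
    (hx : ∀ i, x i ∈ maximalIdeal S) :
    ∃ ψ : MvPowerSeries (Fin n) R →ₐ[R] S, ∀ i, ψ (MvPowerSeries.X i) = x i := by
  -- With discrete coefficients, evaluation only needs the coordinates to be topologically nilpotent
  -- in `S`.
  let _ : UniformSpace R := ⊥
  have : DiscreteUniformity R := ⟨rfl⟩
  let _ : WithIdeal S := ⟨maximalIdeal S⟩
  have hS : CompleteSpace S ∧ T2Space S :=
    (show IsAdic (maximalIdeal S) from rfl).isAdicComplete_iff.1 inferInstance
  have := hS.1
  have := hS.2
  have : ContinuousSMul R S := continuousSMul_of_algebraMap R S continuous_of_discreteTopology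
  have hev : MvPowerSeries.HasEval x :=
    ⟨fun i => WithIdeal.isTopologicallyNilpotent_of_mem (hx i), by
      rw [Filter.cofinite_eq_bot]; exact Filter.tendsto_bot⟩
  refine ⟨MvPowerSeries.aeval (R := R) hev, fun i => ?_⟩
  have h := MvPowerSeries.aeval_coe (R := R) hev (MvPolynomial.X i)
  rwa [MvPolynomial.coe_X, MvPolynomial.aeval_X] at h

theorem mvPowerSeries_ringHom_ext {R S : Type*} [CommRing R] [CommRing S] (J : Ideal S)
    [IsHausdorff J S] {n : ℕ} {φ ψ : MvPowerSeries (Fin n) R →+* S}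
    (hC : ∀ a, φ (MvPowerSeries.C a) = ψ (MvPowerSeries.C a))
    (hX : ∀ i, φ (MvPowerSeries.X i) = ψ (MvPowerSeries.X i))
    (hJ : ∀ i, φ (MvPowerSeries.X i) ∈ J) : φ = ψ := by
  induction n with
  | zero =>
    ext f
    have h1 : f = MvPowerSeries.C (MvPowerSeries.constantCoeff f) := by
      ext m
      rw [Subsingleton.elim m 0]
      simp
    rw [h1, hC]
  | succ n ih =>
    let e := MvPowerSeries.finSuccEquiv R n
    have heC : ∀ a, e.symm (PowerSeries.C (MvPowerSeries.C a)) = MvPowerSeries.C a := fun a => by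
      rw [AlgEquiv.symm_apply_eq, MvPowerSeries.finSuccEquiv_C]
    have heX : e.symm PowerSeries.X = MvPowerSeries.X 0 := by
      rw [AlgEquiv.symm_apply_eq, MvPowerSeries.finSuccEquiv_X_zero]
    have heX' : ∀ i, e.symm (PowerSeries.C (MvPowerSeries.X i)) = MvPowerSeries.X i.succ :=
      fun i => by rw [AlgEquiv.symm_apply_eq, MvPowerSeries.finSuccEquiv_X_succ]
    let ι : PowerSeries (MvPowerSeries (Fin n) R) →+* MvPowerSeries (Fin (n + 1)) R :=
      e.symm.toRingEquiv.toRingHom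
    have h1 : (φ.comp ι).comp PowerSeries.C = (ψ.comp ι).comp PowerSeries.C := by
      refine ih (fun a => ?_) (fun i => ?_) fun i => ?_
      · exact (congrArg φ (heC a)).trans ((hC a).trans (congrArg ψ (heC a)).symm)
      · exact (congrArg φ (heX' i)).trans ((hX _).trans (congrArg ψ (heX' i)).symm)
      · exact (congrArg φ (heX' i)).symm ▸ hJ i.succ
    have h2 : φ.comp ι = ψ.comp ι := by
      refine powerSeries_ringHom_ext J (fun a => RingHom.congr_fun h1 a) ?_ ?_
      · exact (congrArg φ heX).trans ((hX 0).trans (congrArg ψ heX).symm)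
      · exact (congrArg φ heX).symm ▸ hJ 0
    ext f
    have h3 := RingHom.congr_fun h2 (e f)
    have h4 : ι (e f) = f := e.symm_apply_apply f
    rwa [RingHom.comp_apply, RingHom.comp_apply, h4] at h3

/-- An algebra homomorphism from a local algebra to a local ring which is integral over the base
is local. -/
theorem comap_maximalIdeal_of_isIntegral {O S O' : Type*} [CommRing O] [CommRing S] [CommRing O']
    [IsLocalRing S] [IsLocalRing O'] [Algebra O S] [Algebra O O'] [Algebra.IsIntegral O O']
    (ψ : S →ₐ[O] O') : (maximalIdeal O').comap ψ.toRingHom = maximalIdeal S := by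
  have hint : ψ.toRingHom.IsIntegral := by
    refine RingHom.IsIntegral.tower_top (algebraMap O S) ψ.toRingHom ?_
    have : ψ.toRingHom.comp (algebraMap O S) = algebraMap O O' := ψ.comp_algebraMap
    rw [this]
    exact algebraMap_isIntegral_iff.2 inferInstance
  exact eq_maximalIdeal (Ideal.isMaximal_comap_of_isIntegral_of_isMaximal' _ hint _)

theorem apply_X_mem_maximalIdeal {O O' : Type*} [CommRing O] [IsLocalRing O] [CommRing O']
    [IsLocalRing O'] [Algebra O O'] [Algebra.IsIntegral O O'] {n : ℕ}
    (ψ : MvPowerSeries (Fin n) O →ₐ[O] O') (i : Fin n) :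
    ψ (MvPowerSeries.X i) ∈ maximalIdeal O' := by
  have h : (MvPowerSeries.X i : MvPowerSeries (Fin n) O) ∈ maximalIdeal _ := by
    rw [mem_maximalIdeal, mem_nonunits_iff, MvPowerSeries.isUnit_iff_constantCoeff]
    simp
  rw [← comap_maximalIdeal_of_isIntegral ψ] at h
  exact h

variable {O : Type u} [CommRing O] [IsDomain O] [IsDiscreteValuationRing O]
  [IsAdicComplete (maximalIdeal O) O] [CharZero O] {ϖ : O}

/-- A power series which is not divisible by the uniformizer takes a value which is not divisible by
the uniformizer. -/
theorem exists_not_dvd_apply (hϖ : Irreducible ϖ) {n : ℕ} {h : MvPowerSeries (Fin n) O}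
    (hh : ¬ MvPowerSeries.C ϖ ∣ h) :
    ∃ (O' : Type u) (_ : CommRing O') (_ : IsDomain O') (_ : IsDiscreteValuationRing O')
      (_ : Algebra O O') (_ : FaithfulSMul O O') (_ : Module.Finite O O')
      (ψ : MvPowerSeries (Fin n) O →ₐ[O] O'), ¬ algebraMap O O' ϖ ∣ ψ h := by
  obtain ⟨N, r, hN, -, -, hr, key⟩ := exists_exponents hϖ n h hh
  -- Adjoining an `r`-th root `π` of `ϖ` makes the bound `π ^ r` from `exists_exponents` equal to
  -- `ϖ`.
  have hP : (Polynomial.X ^ r - Polynomial.C ϖ : Polynomial O).Monic :=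
    Polynomial.monic_X_pow_sub_C _ hr.ne'
  obtain ⟨O', _, _, _, _, _, _, s, hs⟩ := exists_finite_extension_splits O hP
  have := isAdicComplete_of_finite O O'
  have hs0 : s ≠ 0 := by
    rintro rfl
    have h1 := congrArg Polynomial.natDegree hs
    rw [hP.natDegree_map, Polynomial.natDegree_X_pow_sub_C] at h1
    simp at h1
    omega
  obtain ⟨π, hπs⟩ := Multiset.exists_mem_of_ne_zero hs0
  have hπ : π ^ r = algebraMap O O' ϖ := by
    have h1 := congrArg (Polynomial.eval π) hs
    rw [Polynomial.eval_multiset_prod, Multiset.map_map, Multiset.prod_eq_zero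
      (Multiset.mem_map.2 ⟨π, hπs, by simp⟩)] at h1
    simpa [sub_eq_zero] using h1
  have hϖ' : algebraMap O O' ϖ ∈ maximalIdeal O' := by
    have h1 : (maximalIdeal O').comap (algebraMap O O') = maximalIdeal O :=
      eq_maximalIdeal (Ideal.isMaximal_comap_of_isIntegral_of_isMaximal _)
    have h2 : ϖ ∈ maximalIdeal O := hϖ.not_isUnit
    rw [← h1] at h2
    exact h2
  have hπm : π ∈ maximalIdeal O' :=
    (maximalIdeal.isMaximal O').isPrime.mem_of_pow_mem r (hπ ▸ hϖ')
  obtain ⟨ψ, hψ⟩ := exists_algHom_mvPowerSeries O O' (fun i => π ^ N i)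
    fun i => Ideal.pow_mem_of_mem _ hπm _ (hN i)
  refine ⟨O', ‹_›, ‹_›, ‹_›, ‹_›, ‹_›, ‹_›, ψ, fun hdvd => ?_⟩
  have hψϖ : ψ (MvPowerSeries.C ϖ) = π ^ r := (ψ.commutes ϖ).trans hπ.symm
  refine key O' π ?_ hπm ψ.toRingHom hψ hψϖ.symm.dvd (hπ ▸ hdvd)
  rintro rfl
  rw [zero_pow hr.ne'] at hπ
  exact hϖ.ne_zero (FaithfulSMul.algebraMap_injective O O' (hπ.symm.trans (map_zero _).symm))

theorem exists_apply_ne_zero {n : ℕ} {h : MvPowerSeries (Fin n) O} (hh : h ≠ 0) :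
    ∃ (O' : Type u) (_ : CommRing O') (_ : IsDomain O') (_ : IsDiscreteValuationRing O')
      (_ : Algebra O O') (_ : FaithfulSMul O O') (_ : Module.Finite O O')
      (ψ : MvPowerSeries (Fin n) O →ₐ[O] O'), ψ h ≠ 0 := by
  obtain ⟨ϖ, hϖ⟩ := IsDiscreteValuationRing.exists_irreducible O
  obtain ⟨k, g, hg, rfl⟩ := WfDvdMonoid.max_power_factor hh (prime_C (σ := Fin n) hϖ).irreducible
  obtain ⟨O', _, _, _, _, _, _, ψ, hψ⟩ := exists_not_dvd_apply hϖ hg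
  refine ⟨O', ‹_›, ‹_›, ‹_›, ‹_›, ‹_›, ‹_›, ψ, ?_⟩
  rw [map_mul, map_pow]
  refine mul_ne_zero (pow_ne_zero _ fun h0 => hϖ.ne_zero ?_) fun h0 => hψ (h0 ▸ dvd_zero _)
  have h1 : ψ (MvPowerSeries.C ϖ) = algebraMap O O' ϖ := ψ.commutes ϖ
  exact FaithfulSMul.algebraMap_injective O O' (h1.symm.trans (h0.trans (map_zero _).symm))

end Points

/-! ### Divisibility can be tested at points -/

section Divisibility

variable {O : Type u} [CommRing O] [IsDomain O] [IsDiscreteValuationRing O]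
  [IsAdicComplete (maximalIdeal O) O]

theorem finSuccEquiv_symm_C_C {R : Type*} [CommRing R] {n : ℕ} (a : R) :
    (MvPowerSeries.finSuccEquiv R n).symm (PowerSeries.C (MvPowerSeries.C a)) =
      MvPowerSeries.C a := by
  rw [AlgEquiv.symm_apply_eq, MvPowerSeries.finSuccEquiv_C]

theorem finSuccEquiv_symm_X {R : Type*} [CommRing R] {n : ℕ} :
    (MvPowerSeries.finSuccEquiv R n).symm PowerSeries.X = MvPowerSeries.X 0 := by
  rw [AlgEquiv.symm_apply_eq, MvPowerSeries.finSuccEquiv_X_zero]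

theorem finSuccEquiv_symm_C_X {R : Type*} [CommRing R] {n : ℕ} (i : Fin n) :
    (MvPowerSeries.finSuccEquiv R n).symm (PowerSeries.C (MvPowerSeries.X i)) =
      MvPowerSeries.X i.succ := by
  rw [AlgEquiv.symm_apply_eq, MvPowerSeries.finSuccEquiv_X_succ]

/-- A homomorphism on `A` extends to `A⟦t⟧` with a prescribed value of `t` in the maximal ideal. -/
theorem exists_algHom_powerSeries {n : ℕ} {O' : Type u} [CommRing O'] [IsLocalRing O']
    [Algebra O O'] [Module.Finite O O'] (τ : MvPowerSeries (Fin n) O →ₐ[O] O') {β : O'}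
    (hβ : β ∈ maximalIdeal O') :
    ∃ ψ : PowerSeries (MvPowerSeries (Fin n) O) →ₐ[O] O',
      (∀ a, ψ (PowerSeries.C a) = τ a) ∧ ψ PowerSeries.X = β := by
  have := isAdicComplete_of_finite O O'
  have hτ := apply_X_mem_maximalIdeal τ
  obtain ⟨ψ, hψ⟩ := exists_algHom_mvPowerSeries O O'
    (Fin.cons β fun i => τ (MvPowerSeries.X i) : Fin (n + 1) → O')
    (Fin.cases hβ hτ)
  refine ⟨ψ.comp (MvPowerSeries.finSuccEquiv O n).symm.toAlgHom, fun a => ?_, ?_⟩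
  · have h1 : ((ψ.comp (MvPowerSeries.finSuccEquiv O n).symm.toAlgHom).toRingHom.comp
        (PowerSeries.C (R := MvPowerSeries (Fin n) O))) = τ.toRingHom := by
      have hX : ∀ i, ψ ((MvPowerSeries.finSuccEquiv O n).symm
          (PowerSeries.C (MvPowerSeries.X i))) = τ (MvPowerSeries.X i) := fun i => by
        rw [finSuccEquiv_symm_C_X, hψ, Fin.cons_succ]
      refine mvPowerSeries_ringHom_ext (maximalIdeal O') (fun a => ?_) hX fun i => ?_
      · exact (congrArg ψ (finSuccEquiv_symm_C_C a)).trans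
          ((ψ.commutes a).trans (τ.commutes a).symm)
      · exact (hX i).symm ▸ hτ i
    exact RingHom.congr_fun h1 a
  · exact (congrArg ψ finSuccEquiv_symm_X).trans ((hψ 0).trans (Fin.cons_zero _ _))

theorem apply_coe_eq_eval_map {A S : Type*} [CommRing A] [CommRing S] (ψ : PowerSeries A →+* S)
    (τ : A →+* S) (hC : ∀ a, ψ (PowerSeries.C a) = τ a) (P : Polynomial A) :
    ψ (P : PowerSeries A) = (P.map τ).eval (ψ PowerSeries.X) := by
  have h : ψ.comp (Polynomial.coeToPowerSeries.ringHom) =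
      Polynomial.eval₂RingHom τ (ψ PowerSeries.X) := by
    apply Polynomial.ringHom_ext
    · intro a; simpa using hC a
    · simp
  rw [Polynomial.eval_map]
  exact RingHom.congr_fun h P

variable [CharZero O]

/-- If the Weierstrass remainder `r` were nonzero, some coefficient of it would survive at a point
`τ` of `A`. Over an extension splitting `F` there, varying `t` shows that the specialized `F`
divides the specialized `r`, whose degree is too small. -/
theorem coe_dvd_of_forall_apply_dvd {n : ℕ} {F : Polynomial (MvPowerSeries (Fin n) O)}
    (hF : F.IsDistinguishedAt (maximalIdeal _)) (b : PowerSeries (MvPowerSeries (Fin n) O))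
    (h : ∀ (O' : Type u) [CommRing O'] [IsDomain O'] [IsDiscreteValuationRing O'] [Algebra O O']
      [FaithfulSMul O O'] [Module.Finite O O']
      (ψ : PowerSeries (MvPowerSeries (Fin n) O) →ₐ[O] O'), ψ F ∣ ψ b) :
    (F : PowerSeries (MvPowerSeries (Fin n) O)) ∣ b := by
  have hcomp := isAdicComplete_mvPowerSeries n O inferInstance
  have hdiv := hF.isWeierstrassDivisorAt'.isWeierstrassDivisionAt_div_mod b
  generalize hF.isWeierstrassDivisorAt'.div b = q at hdiv
  generalize hF.isWeierstrassDivisorAt'.mod b = r at hdiv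
  obtain ⟨hdeg, hb⟩ := hdiv
  -- Weierstrass division bounds the degree of `r` by the order of `F` modulo the maximal ideal,
  -- which is the degree of `F` as `F` is distinguished.
  have hord : F.natDegree = ((F : PowerSeries (MvPowerSeries (Fin n) O)).map
      (Ideal.Quotient.mk (maximalIdeal (MvPowerSeries (Fin n) O)))).order.toNat :=
    congr(ENat.toNat $(hF.coe_natDegree_eq_order_map (F : PowerSeries (MvPowerSeries (Fin n) O)) 1
      (by rw [map_one, ← Ideal.ne_top_iff_one]; exact Ideal.IsPrime.ne_top') (by simp)))
  rw [← hord] at hdeg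
  suffices hr : r = 0 by rw [hb, hr, Polynomial.coe_zero, add_zero]; exact dvd_mul_right _ _
  by_contra hr
  obtain ⟨i, hi⟩ : ∃ i, r.coeff i ≠ 0 := by
    by_contra! h0
    exact hr (Polynomial.ext (by simpa using h0))
  obtain ⟨O₁, _, _, _, _, _, _, τ, hτ⟩ := exists_apply_ne_zero hi
  have := isAdicComplete_of_finite O O₁
  have : CharZero O₁ := charZero_of_injective_algebraMap (FaithfulSMul.algebraMap_injective O O₁)
  obtain ⟨O₂, _, _, _, _, _, _, s, hs⟩ :=
    exists_finite_extension_splits O₁ (hF.monic.map τ.toRingHom)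
  let _ : Algebra O O₂ := ((algebraMap O₁ O₂).comp (algebraMap O O₁)).toAlgebra
  have : IsScalarTower O O₁ O₂ := IsScalarTower.of_algebraMap_eq' rfl
  have : Module.Finite O O₂ := Module.Finite.trans O₁ O₂
  have : FaithfulSMul O O₂ := by
    rw [faithfulSMul_iff_algebraMap_injective]
    exact (FaithfulSMul.algebraMap_injective O₁ O₂).comp (FaithfulSMul.algebraMap_injective O O₁)
  let τ₂ : MvPowerSeries (Fin n) O →ₐ[O] O₂ := (IsScalarTower.toAlgHom O O₁ O₂).comp τ
  have hs2 : F.map τ₂.toRingHom = (s.map fun a => Polynomial.X - Polynomial.C a).prod := by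
    rw [← hs, Polynomial.map_map]
    rfl
  -- The lower coefficients of the specialized `F` lie in the maximal ideal, so a power of each root
  -- does too.
  have hsm : ∀ a ∈ s, a ∈ maximalIdeal O₂ := fun a ha => by
    have hroot : (F.map τ₂.toRingHom).IsRoot a := by
      rw [hs2, Polynomial.IsRoot, Polynomial.eval_multiset_prod, Multiset.map_map]
      exact Multiset.prod_eq_zero (Multiset.mem_map.2 ⟨a, ha, by simp⟩)
    have hle : (maximalIdeal (MvPowerSeries (Fin n) O)).map τ₂.toRingHom ≤ maximalIdeal O₂ := by
      rw [Ideal.map_le_iff_le_comap, comap_maximalIdeal_of_isIntegral τ₂]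
    have hE : (F.map τ₂.toRingHom).IsWeaklyEisensteinAt (maximalIdeal O₂) :=
      ⟨fun {j} hj => by
        rw [Polynomial.coeff_map]
        refine hle (Ideal.mem_map_of_mem _ (hF.mem ?_))
        rwa [hF.monic.natDegree_map] at hj⟩
    exact (maximalIdeal.isMaximal O₂).isPrime.mem_of_pow_mem _
      (hE.pow_natDegree_le_of_root_of_monic_mem hroot (hF.monic.map _) _ le_rfl)
  have hdvd : F.map τ₂.toRingHom ∣ r.map τ₂.toRingHom := by
    rw [hs2]
    refine prod_X_sub_C_dvd_of_forall_eval_dvd s hsm _ fun β hβ => ?_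
    obtain ⟨ψ, hψC, hψX⟩ := exists_algHom_powerSeries τ₂ hβ
    have h1 := h O₂ ψ
    rw [hb, map_add, map_mul, dvd_add_right (dvd_mul_right _ _)] at h1
    have h2 := apply_coe_eq_eval_map ψ.toRingHom τ₂.toRingHom hψC
    have h3 : ψ.toRingHom PowerSeries.X = β := hψX
    rw [h3] at h2
    rw [← hs2, ← h2, ← h2]
    exact h1
  have hr0 : r.map τ₂.toRingHom = 0 := by
    refine Polynomial.eq_zero_of_dvd_of_degree_lt hdvd ?_
    rw [hF.monic.degree_map, Polynomial.degree_eq_natDegree hF.monic.ne_zero]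
    exact (Polynomial.degree_map_le).trans_lt hdeg
  have h4 := congrArg (fun P => Polynomial.coeff P i) hr0
  rw [Polynomial.coeff_map, Polynomial.coeff_zero] at h4
  exact hτ (FaithfulSMul.algebraMap_injective O₁ O₂ (h4.trans (map_zero _).symm))

theorem dvd_of_forall_apply_dvd_of_map_residue_ne_zero {n : ℕ}
    {g b : PowerSeries (MvPowerSeries (Fin n) O)} (hg : g.map (residue _) ≠ 0)
    (h : ∀ (O' : Type u) [CommRing O'] [IsDomain O'] [IsDiscreteValuationRing O'] [Algebra O O']
      [FaithfulSMul O O'] [Module.Finite O O']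
      (ψ : PowerSeries (MvPowerSeries (Fin n) O) →ₐ[O] O'), ψ g ∣ ψ b) : g ∣ b := by
  have hcomp := isAdicComplete_mvPowerSeries n O inferInstance
  obtain ⟨F, u, hF, hu, hgF⟩ := PowerSeries.exists_isWeierstrassFactorization hg
  have h1 : Associated (F : PowerSeries (MvPowerSeries (Fin n) O)) g :=
    ⟨hu.unit, by rw [hgF]; rfl⟩
  refine h1.symm.dvd.trans (coe_dvd_of_forall_apply_dvd hF b ?_)
  intro O' _ _ _ _ _ _ ψ
  exact (map_dvd ψ h1.dvd).trans (h O' ψ)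

/-- Divisibility in `O⟦T₀, …, Tₙ⟧` can be tested at the points of the open unit polydisc with
coordinates in finite extensions. -/
theorem dvd_of_forall_apply_dvd {n : ℕ} {f b : MvPowerSeries (Fin (n + 1)) O} (hf : f ≠ 0)
    (h : ∀ (O' : Type u) [CommRing O'] [IsDomain O'] [IsDiscreteValuationRing O'] [Algebra O O']
      [FaithfulSMul O O'] [Module.Finite O O']
      (ψ : MvPowerSeries (Fin (n + 1)) O →ₐ[O] O'), ψ f ∣ ψ b) : f ∣ b := by
  obtain ⟨ϖ, hϖ⟩ := IsDiscreteValuationRing.exists_irreducible O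
  have hp := prime_C (σ := Fin (n + 1)) hϖ
  obtain ⟨k, g, hg, rfl⟩ := WfDvdMonoid.max_power_factor hf hp.irreducible
  induction k generalizing b with
  | zero =>
    rw [pow_zero, one_mul] at h ⊢
    obtain ⟨e, he⟩ := exists_algEquiv_map_residue_ne_zero hϖ n g hg
    have h1 : e g ∣ e b := by
      refine dvd_of_forall_apply_dvd_of_map_residue_ne_zero he ?_
      intro O' _ _ _ _ _ _ ψ
      exact h O' (ψ.comp e.toAlgHom)
    have h2 := map_dvd e.symm h1
    rwa [e.symm_apply_apply, e.symm_apply_apply] at h2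
  | succ k ih =>
    -- Otherwise `b` would have a value not divisible by `ϖ`, although `ϖ` divides every value of
    -- the divisor.
    obtain ⟨c, rfl⟩ : MvPowerSeries.C ϖ ∣ b := by
      by_contra hb
      obtain ⟨O', _, _, _, _, _, _, ψ, hψ⟩ := exists_not_dvd_apply hϖ hb
      have h1 : ψ (MvPowerSeries.C ϖ) = algebraMap O O' ϖ := ψ.commutes ϖ
      refine hψ (Dvd.dvd.trans ?_ (h O' ψ))
      rw [← h1]
      exact map_dvd ψ ((dvd_pow_self _ k.succ_ne_zero).mul_right g)
    rw [pow_succ', mul_assoc] at h ⊢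
    refine mul_dvd_mul_left _ (ih (right_ne_zero_of_mul (a := MvPowerSeries.C ϖ) ?_) ?_)
    · rwa [pow_succ', mul_assoc] at hf
    · intro O' _ _ _ _ _ _ ψ
      have h1 := h O' ψ
      rw [map_mul ψ _ c, map_mul ψ (MvPowerSeries.C ϖ)] at h1
      refine (mul_dvd_mul_iff_left ?_).1 h1
      have h2 : ψ (MvPowerSeries.C ϖ) = algebraMap O O' ϖ := ψ.commutes ϖ
      rw [h2]
      exact fun h0 => hϖ.ne_zero (FaithfulSMul.algebraMap_injective O O'
        (h0.trans (map_zero _).symm))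

end Divisibility

/-! ### Twists and specialization -/

section TwistInverse

variable {n : ℕ} {R : Type u} [CommRing R] [IsLocalRing R] [IsAdicComplete (maximalIdeal R) R]

theorem twist_C (α : principalUnits R) (a : RingA n R) :
    twist n α (PowerSeries.C a) = PowerSeries.C a :=
  (twist n α).commutes a

/-- Twisting multiplies `1 + t` by a constant, so the composite fixes `t` and `A`; as `B` is
Hausdorff for its maximal ideal, it is the identity. -/
theorem twist_twist_inv [IsNoetherianRing R] (α : principalUnits R) (f : RingB n R) :
    twist n α (twist n α⁻¹ f) = f := by
  have hA := isAdicComplete_mvPowerSeries n R inferInstance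
  have hB := isAdicComplete_powerSeries (RingA n R)
  have hX : twist n α (twist n α⁻¹ PowerSeries.X) = PowerSeries.X := by
    have h1 : (PowerSeries.C (MvPowerSeries.C (((α⁻¹ : principalUnits R) : Rˣ) : R)) : RingB n R) *
        PowerSeries.C (MvPowerSeries.C ((α : Rˣ) : R)) = 1 := by
      rw [← map_mul, ← map_mul]
      simp
    rw [twist_X, map_sub, map_mul, map_add, map_one, twist_C, twist_X]
    linear_combination (1 + PowerSeries.X) * h1
  have h : ((twist n α).comp (twist n α⁻¹)).toRingHom = RingHom.id (RingB n R) := by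
    refine powerSeries_ringHom_ext (maximalIdeal (RingB n R)) (fun a => ?_) hX ?_
    · exact (congrArg (twist n α) (twist_C α⁻¹ a)).trans (twist_C α a)
    · have h2 : (PowerSeries.X : RingB n R) ∈ maximalIdeal (RingB n R) := by
        rw [mem_maximalIdeal, mem_nonunits_iff, PowerSeries.isUnit_iff_constantCoeff]
        simp
      exact hX.symm ▸ h2
  exact RingHom.congr_fun h f

theorem twist_inv_twist [IsNoetherianRing R] (α : principalUnits R) (f : RingB n R) :
    twist n α⁻¹ (twist n α f) = f := by
  simpa using twist_twist_inv α⁻¹ f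

/-- The identity map from `Y` to `Tw_α(Y)`. -/
def toTwistModule (α : principalUnits R) (Y : Type v) [AddCommGroup Y] :
    Y ≃+ TwistModule α Y :=
  AddEquiv.refl Y

theorem smul_toTwistModule (α : principalUnits R) {Y : Type v} [AddCommGroup Y]
    [Module (RingB n R) Y] (c : RingB n R) (y : Y) :
    c • toTwistModule α Y y = toTwistModule α Y (twist n α c • y) :=
  rfl

theorem span_toTwistModule [IsNoetherianRing R] (α : principalUnits R) {Y : Type v}
    [AddCommGroup Y] [Module (RingB n R) Y] {ι : Type*} {y : ι → Y}
    (hy : Submodule.span (RingB n R) (Set.range y) = ⊤) :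
    Submodule.span (RingB n R) (Set.range fun j => toTwistModule α Y (y j)) = ⊤ := by
  rw [eq_top_iff]
  intro z _
  obtain ⟨w, rfl⟩ := (toTwistModule α Y).surjective z
  have hw : w ∈ Submodule.span (RingB n R) (Set.range y) := hy ▸ trivial
  induction hw using Submodule.span_induction with
  | mem w hw =>
    obtain ⟨j, rfl⟩ := hw
    exact Submodule.subset_span ⟨j, rfl⟩
  | zero => rw [map_zero]; exact Submodule.zero_mem _
  | add a b _ _ ha hb => rw [map_add]; exact Submodule.add_mem _ (ha trivial) (hb trivial)
  | smul c w _ hw =>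
    have h1 := Submodule.smul_mem _ (twist n α⁻¹ c) (hw trivial)
    rwa [smul_toTwistModule, twist_twist_inv] at h1

end TwistInverse

/-! ### The quotient by `t` and its relations -/

section QuotT

variable {n : ℕ} {R : Type u} [CommRing R] {Y : Type v} [AddCommGroup Y] [Module (RingB n R) Y]

/-- The projection `Y → Y / t Y`. -/
def toQuotT (n : ℕ) (R : Type u) [CommRing R] (Y : Type v) [AddCommGroup Y]
    [Module (RingB n R) Y] : Y →ₗ[RingB n R] QuotT n R Y :=
  Submodule.mkQ _

theorem toQuotT_surjective : Function.Surjective (toQuotT n R Y) :=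
  Submodule.mkQ_surjective _

theorem toQuotT_eq_zero_iff (y : Y) :
    toQuotT n R Y y = 0 ↔ ∃ w : Y, (PowerSeries.X : RingB n R) • w = y := by
  have h : toQuotT n R Y y = 0 ↔
      y ∈ (Ideal.span {(PowerSeries.X : RingB n R)} • ⊤ : Submodule (RingB n R) Y) :=
    Submodule.Quotient.mk_eq_zero _
  rw [h, Submodule.ideal_span_singleton_smul, Submodule.mem_smul_pointwise_iff_exists]
  simp

theorem toQuotT_C_smul (a : RingA n R) (y : Y) :
    toQuotT n R Y ((PowerSeries.C a : RingB n R) • y) = a • toQuotT n R Y y :=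
  map_smul _ _ _

theorem toQuotT_smul (c : RingB n R) (y : Y) :
    toQuotT n R Y (c • y) = PowerSeries.constantCoeff c • toQuotT n R Y y := by
  conv_lhs => rw [PowerSeries.eq_X_mul_shift_add_const c]
  rw [add_smul, map_add, mul_smul, (toQuotT_eq_zero_iff _).2 ⟨_, rfl⟩, zero_add, toQuotT_C_smul]

theorem span_toQuotT {ι : Type*} {y : ι → Y}
    (hy : Submodule.span (RingB n R) (Set.range y) = ⊤) :
    Submodule.span (RingA n R) (Set.range fun j => toQuotT n R Y (y j)) = ⊤ := by
  rw [eq_top_iff]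
  intro z _
  obtain ⟨w, rfl⟩ := toQuotT_surjective z
  have hw : w ∈ Submodule.span (RingB n R) (Set.range y) := hy ▸ trivial
  induction hw using Submodule.span_induction with
  | mem w hw =>
    obtain ⟨j, rfl⟩ := hw
    exact Submodule.subset_span ⟨j, rfl⟩
  | zero => rw [map_zero]; exact Submodule.zero_mem _
  | add a b _ _ ha hb => rw [map_add]; exact Submodule.add_mem _ (ha trivial) (hb trivial)
  | smul c w _ hw => rw [toQuotT_smul]; exact Submodule.smul_mem _ _ (hw trivial)

/-- A relation matrix for `Y / t Y` is a relation matrix for every quotient of `Y` on which the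
power series act through their constant coefficient. -/
theorem IsRelationMatrix.of_toQuotT {ι N : Type*} [Fintype ι] [AddCommGroup N]
    [Module (RingA n R) N] {y : ι → Y} {A : Matrix ι ι (RingA n R)}
    (hA : IsRelationMatrix (fun j => toQuotT n R Y (y j)) A) (L : Y →+ N)
    (hL : ∀ (c : RingB n R) (z : Y), L (c • z) = PowerSeries.constantCoeff c • L z) :
    IsRelationMatrix (fun j => L (y j)) A := fun i => by
  -- Lifted to `Y`, the relation holds up to a multiple of `t`, and `L` kills such multiples.
  have h1 : toQuotT n R Y (∑ j, (PowerSeries.C (A i j) : RingB n R) • y j) = 0 := by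
    rw [map_sum, ← hA i]
    exact Finset.sum_congr rfl fun j _ => toQuotT_C_smul _ _
  obtain ⟨w, hw⟩ := (toQuotT_eq_zero_iff _).1 h1
  have h2 := congrArg L hw
  rw [hL, PowerSeries.constantCoeff_X, zero_smul, map_sum] at h2
  rw [h2]
  exact Finset.sum_congr rfl fun j _ => by rw [hL, PowerSeries.constantCoeff_C]

end QuotT

/-- Base change of Fitting ideals along `ρ`, with `hA` ranging over all `ρ`-semilinear targets so
that no isomorphism with a tensor product has to be built. The target actually used is `T ⊗ X`,
which fixes the universe of `N`. -/
theorem dvd_det_of_semilinear {R S : Type*} {T : Type u} {X : Type v} [CommRing R] [CommRing S]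
    [CommRing T] [Algebra R S] [AddCommGroup X] [Module R X] {ι : Type*} [Fintype ι]
    [DecidableEq ι] {x : ι → X} (hx : Submodule.span R (Set.range x) = ⊤) {g : R}
    (hg : ∀ A : Matrix ι ι R, IsRelationMatrix x A → g ∣ A.det) (ρ : S →+* T) (A : Matrix ι ι T)
    (hA : ∀ (N : Type (max u v)) [AddCommGroup N] [Module T N] (L : S ⊗[R] X →+ N),
      (∀ (c : S) (z : S ⊗[R] X), L (c • z) = ρ c • L z) →
        IsRelationMatrix (fun j => L ((1 : S) ⊗ₜ[R] x j)) A) :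
    ρ (algebraMap R S g) ∣ A.det := by
  let _ : Algebra R T := (ρ.comp (algebraMap R S)).toAlgebra
  let ρ' : S →ₐ[R] T := { ρ with commutes' := fun _ => rfl }
  have h : ∀ (c : S) (z : S ⊗[R] X), LinearMap.rTensor X ρ'.toLinearMap (c • z) =
      ρ c • LinearMap.rTensor X ρ'.toLinearMap z := fun c z => by
    induction z with
    | zero => simp
    | tmul s x =>
      rw [TensorProduct.smul_tmul', LinearMap.rTensor_tmul, LinearMap.rTensor_tmul,
        TensorProduct.smul_tmul', smul_eq_mul]
      exact congrArg (· ⊗ₜ[R] x) (map_mul ρ c s)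
    | add a b ha hb => rw [smul_add, map_add, map_add, smul_add, ha, hb]
  refine algebraMap_dvd_det_of_isRelationMatrix_baseChange (S := T) hx hg A ?_
  have h1 := hA (T ⊗[R] X) (LinearMap.rTensor X ρ'.toLinearMap).toAddMonoidHom h
  have h2 : ∀ j, (LinearMap.rTensor X ρ'.toLinearMap) ((1 : S) ⊗ₜ[R] x j) =
      (1 : T) ⊗ₜ[R] x j := fun j =>
    (LinearMap.rTensor_tmul _ _ _ _).trans (congrArg (· ⊗ₜ[R] x j) (map_one ρ))
  exact fun i => by simpa only [h2, LinearMap.toAddMonoidHom_coe] using h1 i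

theorem span_one_tmul {R S X : Type*} [CommRing R] [CommRing S] [Algebra R S] [AddCommGroup X]
    [Module R X] {ι : Type*} {x : ι → X} (hx : Submodule.span R (Set.range x) = ⊤) :
    Submodule.span S (Set.range fun j => (1 : S) ⊗ₜ[R] x j) = ⊤ := by
  have h := congrArg (Submodule.baseChange S) hx
  rw [Submodule.baseChange_span, Submodule.baseChange_top, ← Set.range_comp] at h
  exact h

/-! ### Specializations of `X` and points of `B` -/

section Specialization

variable {O O' : Type u} [CommRing O] [CommRing O'] [IsDomain O'] [IsDiscreteValuationRing O']
  [IsAdicComplete (maximalIdeal O') O'] [Algebra O O'] {n : ℕ}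

/-- If `g` divides all relation determinants of `X`, its specialization divides every element of the
characteristic ideal of the specialization of `X`. -/
theorem constantCoeff_twist_dvd {X : Type v} [AddCommGroup X] [Module (RingB n O) X]
    {ι : Type*} [Fintype ι] [DecidableEq ι] {x : ι → X}
    (hx : Submodule.span (RingB n O) (Set.range x) = ⊤) {g b : RingB n O}
    (hg : ∀ A : Matrix ι ι (RingB n O), IsRelationMatrix x A → g ∣ A.det) (α : principalUnits O')
    (hb : PowerSeries.constantCoeff (twist n α⁻¹ (algebraMap (RingB n O) (RingB n O') b)) ∈
      charIdeal (RingA n O') (QuotT n O' (TwistModule α (RingB n O' ⊗[RingB n O] X)))) :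
    PowerSeries.constantCoeff (twist n α⁻¹ (algebraMap (RingB n O) (RingB n O') g)) ∣
      PowerSeries.constantCoeff (twist n α⁻¹ (algebraMap (RingB n O) (RingB n O') b)) := by
  have := uniqueFactorizationMonoid_mvPowerSeries O' n
  refine dvd_of_mem_charIdeal (span_toQuotT (span_toTwistModule α (span_one_tmul hx)))
    (fun A hA => ?_) hb
  refine dvd_det_of_semilinear hx hg
    (PowerSeries.constantCoeff.comp (twist n α⁻¹).toRingHom) A fun N _ _ L hL => ?_
  refine hA.of_toQuotT (L.comp (toTwistModule α (RingB n O' ⊗[RingB n O] X)).symm.toAddMonoidHom)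
    fun c z => ?_
  -- On `Tw_α`, `c` acts through `Tw_α(c)`, which `Tw_{α⁻¹}` turns back into `c`; what remains is
  -- the constant coefficient.
  refine (hL (twist n α c) _).trans (congrArg (· • L _) ?_)
  exact congrArg PowerSeries.constantCoeff (twist_inv_twist α c)

/-- Every point of the formal polydisc factors through a specialization `π ∘ Tw_α⁻¹`. -/
theorem exists_algHom_comp_twist [IsLocalRing O] [Module.Finite O O']
    (ψ : RingB n O →ₐ[O] O') :
    ∃ (α : principalUnits O') (ev : RingA n O' →+* O'), ∀ f : RingB n O,
      ψ f = ev (PowerSeries.constantCoeff (twist n α⁻¹ (algebraMap (RingB n O) (RingB n O') f))) := by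
  have hXm : (PowerSeries.X : RingB n O) ∈ maximalIdeal (RingB n O) := by
    rw [mem_maximalIdeal, mem_nonunits_iff, PowerSeries.isUnit_iff_constantCoeff]
    simp
  have hβ : ψ PowerSeries.X ∈ maximalIdeal O' := by
    rw [← comap_maximalIdeal_of_isIntegral ψ] at hXm
    exact hXm
  have hu : IsUnit (1 + ψ PowerSeries.X) := by
    by_contra hu
    have h1 := sub_mem ((mem_maximalIdeal _).2 hu) hβ
    rw [add_sub_cancel_right] at h1
    exact (maximalIdeal.isMaximal O').ne_top ((Ideal.eq_top_iff_one _).2 h1)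
  -- With `γ = 1 + ψ(t)`, the constant term of `Tw_γ(t)` is `γ - 1 = ψ(t)`. The required `α` is
  -- `γ⁻¹`, because the specialization uses `α⁻¹`.
  let γ : principalUnits O' := ⟨hu.unit, by
    change (hu.unit : O') - 1 ∈ maximalIdeal O'
    rwa [IsUnit.unit_spec, add_sub_cancel_left]⟩
  let ψA : RingA n O →ₐ[O] O' :=
    { ψ.toRingHom.comp PowerSeries.C with
      commutes' := fun a =>
        (congrArg ψ (PowerSeries.algebraMap_apply (R := O) (A := RingA n O) (r := a)).symm).trans (ψ.commutes a) }
  obtain ⟨ev, hev⟩ := exists_algHom_mvPowerSeries O' O' (fun i => ψA (MvPowerSeries.X i))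
    (apply_X_mem_maximalIdeal ψA)
  refine ⟨γ⁻¹, ev.toRingHom, fun f => ?_⟩
  rw [inv_inv]
  have hA : ψA.toRingHom = ev.toRingHom.comp (MvPowerSeries.map (algebraMap O O')) := by
    refine mvPowerSeries_ringHom_ext (maximalIdeal O') (fun a => ?_) (fun i => ?_)
      (apply_X_mem_maximalIdeal ψA)
    · exact (ψA.commutes a).trans ((ev.commutes (algebraMap O O' a)).symm.trans
        (congrArg ev (MvPowerSeries.map_C (algebraMap O O') a).symm))
    · exact (hev i).symm.trans (congrArg ev (MvPowerSeries.map_X (algebraMap O O') i).symm)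
  have h : ψ.toRingHom = ((ev.toRingHom.comp PowerSeries.constantCoeff).comp
      (twist n γ).toRingHom).comp (algebraMap (RingB n O) (RingB n O')) := by
    refine powerSeries_ringHom_ext (maximalIdeal O') (fun a => ?_) ?_ hβ
    · have h1 : algebraMap (RingB n O) (RingB n O') (PowerSeries.C a) =
          PowerSeries.C (MvPowerSeries.map (algebraMap O O') a) := PowerSeries.map_C _ _
      have h2 : twist n γ (PowerSeries.C (MvPowerSeries.map (algebraMap O O') a)) = _ :=
        twist_C γ _
      rw [RingHom.comp_apply, h1]
      refine (RingHom.congr_fun hA a).trans (congrArg ev ?_)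
      exact ((congrArg PowerSeries.constantCoeff h2).trans (PowerSeries.constantCoeff_C _)).symm
    · have h1 : algebraMap (RingB n O) (RingB n O') PowerSeries.X = PowerSeries.X :=
        PowerSeries.map_X _
      have h2 : PowerSeries.constantCoeff (twist n γ PowerSeries.X) =
          MvPowerSeries.C (ψ PowerSeries.X) := by
        rw [twist_X]
        simp [γ]
      rw [RingHom.comp_apply, h1]
      exact ((congrArg ev h2).trans (ev.commutes _)).symm
  exact RingHom.congr_fun h f

end Specialization

/-! ### Divisibility in `B` -/

section RingB

variable {O : Type u} [CommRing O] [IsDomain O] [IsDiscreteValuationRing O]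
  [IsAdicComplete (maximalIdeal O) O] [CharZero O] {n : ℕ}

theorem ringB_dvd_of_forall_apply_dvd {f b : RingB n O}
    (h : ∀ (O' : Type u) [CommRing O'] [IsDomain O'] [IsDiscreteValuationRing O'] [Algebra O O']
      [FaithfulSMul O O'] [Module.Finite O O'] (ψ : RingB n O →ₐ[O] O'), ψ f ∣ ψ b) : f ∣ b := by
  let e := MvPowerSeries.finSuccEquiv O n
  have key : e.symm f ∣ e.symm b := by
    -- For `f = 0`, `b` vanishes at every point, and a nonzero series has a nonzero value somewhere.
    by_cases hf : f = 0
    · subst hf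
      suffices hb : e.symm b = 0 by rw [hb, map_zero]
      by_contra hb
      obtain ⟨O', _, _, _, _, _, _, ψ, hψ⟩ := exists_apply_ne_zero hb
      have h1 := h O' (ψ.comp e.symm.toAlgHom)
      rw [map_zero, zero_dvd_iff] at h1
      exact hψ h1
    · refine dvd_of_forall_apply_dvd (fun h0 => hf ?_) ?_
      · exact (map_eq_zero_iff e.symm e.symm.injective).1 h0
      · intro O' _ _ _ _ _ _ ψ
        exact h O' (ψ.comp e.symm.toAlgHom)
  have h2 := map_dvd e key
  rwa [e.apply_symm_apply, e.apply_symm_apply] at h2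

instance : IsDomain (RingB n O) := isDomain_mvPowerSeries

theorem uniqueFactorizationMonoid_ringB (n : ℕ) (O : Type u) [CommRing O] [IsDomain O]
    [IsDiscreteValuationRing O] [IsAdicComplete (maximalIdeal O) O] :
    UniqueFactorizationMonoid (RingB n O) :=
  have := uniqueFactorizationMonoid_mvPowerSeries O (n + 1)
  (MvPowerSeries.finSuccEquiv O n).toMulEquiv.uniqueFactorizationMonoid this

end RingB

end IwasawaSpec

end

/-! ### Conclusion -/

open IwasawaSpec in
theorem mainTheorem2 {p : ℕ} [Fact p.Prime]
    {O : Type u} [CommRing O] [IsDomain O] [IsDiscreteValuationRing O]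
    [Algebra ℤ_[p] O] [FaithfulSMul ℤ_[p] O] [Module.Finite ℤ_[p] O]
    (d : ℕ) (hd : 2 ≤ d)
    (X : Type v) [AddCommGroup X] [Module (RingB (d - 1) O) X] [Module.Finite (RingB (d - 1) O) X]
    (b : RingB (d - 1) O)
    (h : ∀ (O' : Type u) [CommRing O'] [IsDomain O'] [IsDiscreteValuationRing O']
      [Algebra O O'] [FaithfulSMul O O'] [Module.Finite O O'],
      haveI := isAdicComplete_of_finite_padicInt p O
      haveI := isAdicComplete_of_finite O O'
      ∀ α : principalUnits O',
        PowerSeries.constantCoeff (twist (d - 1) α⁻¹ (algebraMap (RingB (d - 1) O) (RingB (d - 1) O') b)) ∈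
          charIdeal (RingA (d - 1) O')
            (QuotT (d - 1) O' (TwistModule α (RingB (d - 1) O' ⊗[RingB (d - 1) O] X)))) :
    b ∈ charIdeal (RingB (d - 1) O) X ∧ (b ≠ 0 → Module.IsTorsion (RingB (d - 1) O) X) := by
  have hcomp := isAdicComplete_of_finite_padicInt p O
  have hchar : CharZero O :=
    charZero_of_injective_algebraMap (FaithfulSMul.algebraMap_injective ℤ_[p] O)
  have hufd := uniqueFactorizationMonoid_ringB (d - 1) O
  obtain ⟨m, x, hx⟩ := Module.Finite.exists_fin (R := RingB (d - 1) O) (M := X)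
  have key : ∀ g : RingB (d - 1) O,
      (∀ A : Matrix (Fin m) (Fin m) (RingB (d - 1) O), IsRelationMatrix x A → g ∣ A.det) →
        g ∣ b := fun g hg => by
    refine ringB_dvd_of_forall_apply_dvd ?_
    intro O' _ _ _ _ _ _ ψ
    have := isAdicComplete_of_finite O O'
    obtain ⟨α, ev, hev⟩ := exists_algHom_comp_twist ψ
    rw [hev, hev]
    exact map_dvd ev (constantCoeff_twist_dvd hx hg α (h O' α))
  by_cases htor : Module.IsTorsion (RingB (d - 1) O) X
  · refine ⟨?_, fun _ => htor⟩
    obtain ⟨f, hf, hdvd⟩ := exists_charIdeal_eq_span hx htor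
    rw [hf, Ideal.mem_span_singleton]
    exact key f hdvd
  -- Without torsion every relation determinant is zero, so 0 is an admissible common divisor.
  · have hb : b = 0 := zero_dvd_iff.1 (key 0 fun A hA => by
      by_contra hdet
      exact htor ((isTorsion_iff_exists_relationMatrix hx).2
        ⟨A, hA, fun h0 => hdet (zero_dvd_iff.2 h0)⟩))
    exact ⟨hb ▸ Ideal.zero_mem _, fun h0 => absurd hb h0⟩
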